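/- All groups are finite. A non-empty subset $S$ of a group $G$ is product-free if $S\cap SS=\varnothing$, where $SS=\{ab : a,b\in S\}$; a product-free set is locally maximal if it is not contained in a strictly larger product-free set; and $S$ fills $G$ if every non-identity element of $G$ lies in $S\cup SS$. The group $G$ is filled if every locally maximal product-free set of $G$ fills $G$. A $2$-group $G$ is extraspecial if $Z(G)=G'=\Phi(G)\cong C_2$, where $Z(G)$, $G'$ and $\Phi(G)$ denote the centre, the derived group and the Frattini subgroup of $G$. Let $n>1$ and let $G$ be a filled group of order $2^n$. (a) If every filled group of order $2^{n-1}$ is elementary abelian or extraspecial, then $G$ is elementary abelian, or extraspecial, or isomorphic to $E\times C_2$ for some filled extraspecial group $E$ of order $2^{n-1}$. (b) If every filled group of order $2^{n-1}$ is elementary abelian, then $G$ is elementary abelian or extraspecial. -/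

import Mathlib

universe u

namespace FilledGroup

open scoped Pointwise

/-- A non-empty subset `S` of a group is product-free if `S ∩ SS = ∅`. -/
def IsProductFree {G : Type*} [Group G] (S : Set G) : Prop :=
  S.Nonempty ∧ S ∩ (S * S) = ∅

/-- A product-free set is locally maximal if it is not contained in a strictly larger
product-free set. -/
def IsLocallyMaximal {G : Type*} [Group G] (S : Set G) : Prop :=
  IsProductFree S ∧ ∀ T : Set G, IsProductFree T → S ⊆ T → S = T

/-- `S` fills `G` if every non-identity element of `G` lies in `S ∪ SS`. -/
def Fills {G : Type*} [Group G] (S : Set G) : Prop :=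
  {g : G | g ≠ 1} ⊆ S ∪ (S * S)

/-- A group is filled if each of its locally maximal product-free sets fills it. -/
def IsFilled (G : Type*) [Group G] : Prop :=
  ∀ S : Set G, IsLocallyMaximal S → Fills S

/-- Elementary abelian 2-groups: abelian groups in which every element squares to `1`. -/
def IsElementaryAbelianTwo (G : Type*) [Group G] : Prop :=
  (∀ a b : G, a * b = b * a) ∧ ∀ g : G, g ^ 2 = 1

/-- Extraspecial 2-groups: finite 2-groups with `Z(G) = G' = Φ(G) ≅ C₂`. -/
structure IsExtraspecialTwo (G : Type*) [Group G] : Prop where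
  finite : Finite G
  isPGroup : IsPGroup 2 G
  center_eq_commutator : Subgroup.center G = commutator G
  commutator_eq_frattini : commutator G = frattini G
  frattini_equiv : Nonempty (frattini G ≃* Multiplicative (ZMod 2))

end FilledGroup

/-! Filledness passes to quotients, since the preimage of a locally maximal product-free set is
locally maximal. Hence for every central involution `z` of `G` the quotient `G/⟨z⟩` is filled, so it
is elementary abelian or extraspecial.

If one such quotient is elementary abelian, all squares and commutators of `G` lie in `{1, z}`. A
filled group of this kind has no central square root of `z`. So, unless `G` is elementary abelian,
either its centre is `⟨z⟩` and `G` is extraspecial, or there is another central involution `w`. Then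
`G/⟨w⟩` is extraspecial, and a hyperplane containing `z` but not `w` splits off `⟨w⟩` as a direct
factor.

If all such quotients are extraspecial, `G` is not filled. Let `{1, z, u, uz}` be the preimage of
the centre of `G/⟨z⟩`. If `u` is not central, `G` has maximal class and order 16
(`not_isFilled_of_class_three`). If `u` is central, `Z(G)` is a four-group, and squares and
commutators give a quadratic map `q` and its polar form `B` with values in `F₂²`. A noncentral
involution yields a filled extraspecial quotient containing a four-group that meets the centre
trivially, against `Nondegenerate.not_isFilled`; without one, `not_isFilled_of_anisotropic` applies.

The basic obstructions all exhibit a product-free seed and an element that no product-free extension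
`S` can reach by `S ∪ SS`. Part (b) follows from (a): an extraspecial factor would have to be
abelian. -/

namespace FilledGroup

open scoped Pointwise commutatorElement

/-! ### Product-free sets and quotients -/

section ProductFree

variable {G H : Type*} [Group G] [Group H]

theorem isProductFree_iff {S : Set G} :
    IsProductFree S ↔ S.Nonempty ∧ ∀ a ∈ S, ∀ b ∈ S, a * b ∉ S := by
  unfold IsProductFree
  refine and_congr_right fun _ => ?_
  rw [Set.eq_empty_iff_forall_notMem]
  constructor
  · intro h a ha b hb hab
    exact h _ ⟨hab, Set.mul_mem_mul ha hb⟩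
  · rintro h c ⟨hc, a, ha, b, hb, rfl⟩
    exact h a ha b hb hc

theorem IsProductFree.mul_notMem {S : Set G} (h : IsProductFree S) {a b : G} (ha : a ∈ S)
    (hb : b ∈ S) : a * b ∉ S :=
  (isProductFree_iff.1 h).2 a ha b hb

theorem IsProductFree.one_notMem {S : Set G} (h : IsProductFree S) : (1 : G) ∉ S := fun h1 =>
  h.mul_notMem h1 h1 (by simpa using h1)

theorem IsProductFree.exists_isLocallyMaximal [Finite G] {S : Set G} (h : IsProductFree S) :
    ∃ T : Set G, IsLocallyMaximal T ∧ S ⊆ T := by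
  obtain ⟨T, hST, hT⟩ := (Set.toFinite {T : Set G | IsProductFree T}).exists_le_maximal h
  exact ⟨T, ⟨hT.1, fun U hU hTU => Set.Subset.antisymm hTU (hT.2 hU hTU)⟩, hST⟩

/-- A group is not filled as soon as some non-identity element `x` avoids `S ∪ SS` for all
product-free extensions `S` of a given product-free set. -/
theorem not_isFilled_of_forall_extension [Finite G] {S₀ : Set G} (h₀ : IsProductFree S₀) {x : G}
    (hx : x ≠ 1)
    (h : ∀ S : Set G, IsProductFree S → S₀ ⊆ S → x ∉ S ∧ ∀ m ∈ S, ∀ n ∈ S, m * n ≠ x) :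
    ¬ IsFilled G := by
  intro hG
  obtain ⟨T, hT, hST⟩ := h₀.exists_isLocallyMaximal
  obtain ⟨h1, h2⟩ := h T hT.1 hST
  rcases hG T hT hx with h3 | ⟨m, hm, n, hn, hmn⟩
  · exact h1 h3
  · exact h2 m hm n hn hmn

theorem IsProductFree.preimage {S : Set H} (h : IsProductFree S) {f : G →* H}
    (hf : Function.Surjective f) : IsProductFree (f ⁻¹' S) := by
  rw [isProductFree_iff]
  obtain ⟨s, hs⟩ := h.1
  obtain ⟨g, rfl⟩ := hf s
  refine ⟨⟨g, hs⟩, fun a ha b hb hab => h.mul_notMem ha hb ?_⟩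
  rwa [Set.mem_preimage, map_mul] at hab

/-- A larger product-free set `T` need not be a union of fibres, but it contains all fibres over
`S`. This is enough to lift failures of product-freeness back to `T`. -/
theorem IsLocallyMaximal.preimage {S : Set H} (h : IsLocallyMaximal S) {f : G →* H}
    (hf : Function.Surjective f) : IsLocallyMaximal (f ⁻¹' S) := by
  refine ⟨h.1.preimage hf, fun T hT hST => Set.Subset.antisymm hST fun g hg => ?_⟩
  by_contra hgS
  have hgS' : f g ∉ S := hgS
  -- otherwise `insert (f g) S` would be a larger product-free set
  have key : IsProductFree (insert (f g) S) := by
    rw [isProductFree_iff]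
    have hne : f g ≠ 1 := by
      intro h1
      obtain ⟨s, hs⟩ := h.1.1
      obtain ⟨k, rfl⟩ := hf s
      exact hT.mul_notMem hg (hST (show k ∈ f ⁻¹' S from hs))
        (hST (show g * k ∈ f ⁻¹' S by simpa [h1] using hs))
    have lift : ∀ k : G, f k ∈ S → k ∈ T := fun k hk => hST hk
    refine ⟨⟨_, Set.mem_insert _ _⟩, ?_⟩
    rintro a ha b hb hab
    rcases ha with rfl | ha
    · rcases hb with rfl | hb
      · rcases hab with hab | hab
        · exact hne (by simpa using hab)
        · exact hT.mul_notMem hg hg (lift _ (by simpa using hab))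
      · obtain ⟨k, rfl⟩ := hf b
        rcases hab with hab | hab
        · exact h.1.one_notMem (by rwa [mul_eq_left.1 hab] at hb)
        · exact hT.mul_notMem hg (lift k hb) (lift _ (by simpa using hab))
    · obtain ⟨k, rfl⟩ := hf a
      rcases hb with rfl | hb
      · rcases hab with hab | hab
        · exact h.1.one_notMem (by rwa [mul_eq_right.1 hab] at ha)
        · exact hT.mul_notMem (lift k ha) hg (lift _ (by simpa using hab))
      · rcases hab with hab | hab
        · refine hT.mul_notMem (lift k ha) (lift (k⁻¹ * g) ?_) (by simpa using hg)
          rwa [map_mul, map_inv, ← hab, inv_mul_cancel_left]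
        · exact h.1.mul_notMem ha hb hab
  have := h.2 _ key (Set.subset_insert _ _)
  exact hgS' (this ▸ Set.mem_insert _ _)

theorem IsFilled.of_surjective (hG : IsFilled G) {f : G →* H} (hf : Function.Surjective f) :
    IsFilled H := by
  intro S hS y hy
  obtain ⟨g, rfl⟩ := hf y
  have hg : g ≠ 1 := by
    rintro rfl
    exact hy (map_one f)
  rcases hG _ (hS.preimage hf) hg with h | ⟨a, ha, b, hb, hab⟩
  · exact Or.inl h
  · refine Or.inr ⟨f a, ha, f b, hb, ?_⟩
    simp only [← hab, map_mul]

/-- A filled group in which all squares lie in `{1, z}` has no central square root of `z`. -/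
theorem not_isFilled_of_central_sqrt [Finite G] {z x : G} (hz : z ≠ 1)
    (hsq : ∀ g : G, g * g = 1 ∨ g * g = z) (hx : ∀ g, g * x = x * g) (hxz : x * x = z) :
    ¬ IsFilled G := by
  have hzz : z * z = 1 := by
    rcases hsq z with h | h
    · exact h
    · exact absurd (mul_eq_left.1 h) hz
  have h₀ : IsProductFree ({z} : Set G) := by
    rw [isProductFree_iff]
    refine ⟨⟨z, rfl⟩, ?_⟩
    rintro a rfl b rfl h
    exact hz (by rw [← hzz]; exact h.symm)
  refine not_isFilled_of_forall_extension h₀ (x := x) ?_ fun S hS hzS => ?_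
  · rintro rfl
    exact hz (by simpa using hxz.symm)
  -- As `z ∈ S`, no element of `S` squares to `z`, so all square to 1. But `x = mn` gives `m = xn`,
  -- hence `m² = x²n² = z`.
  have hzm : z ∈ S := hzS rfl
  have hsq1 : ∀ s ∈ S, s * s = 1 := fun s hs =>
    (hsq s).resolve_right fun h => hS.mul_notMem hs hs (h ▸ hzm)
  refine ⟨fun h => hS.mul_notMem h h (hxz ▸ hzm), fun m hm n hn hmn => hz ?_⟩
  have hm' : m = x * n := by
    rw [← hmn, mul_assoc, hsq1 n hn, mul_one]
  have := hsq1 m hm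
  rw [hm', mul_assoc, ← mul_assoc n x n, hx n, mul_assoc, hsq1 n hn, mul_one, hxz] at this
  exact this

end ProductFree

/-! ### Squares and commutators as quadratic and bilinear maps -/

/-- The squaring map and the commutator map of a group in which all squares and all commutators
lie in a central elementary abelian 2-subgroup, the image of `ι`. -/
structure CentralForm (G F : Type*) [Group G] [AddCommGroup F] where
  ι : F → G
  ι_add : ∀ a b, ι (a + b) = ι a * ι b
  ι_injective : Function.Injective ι
  ι_comm : ∀ a g, g * ι a = ι a * g
  add_self : ∀ a : F, a + a = 0
  q : G → F
  B : G → G → F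
  mul_self : ∀ g, g * g = ι (q g)
  mul_comm : ∀ g h, g * h = h * g * ι (B g h)

namespace CentralForm

variable {G F : Type*} [Group G] [AddCommGroup F] (Φ : CentralForm G F)

theorem ι_zero : Φ.ι 0 = 1 := by
  have := Φ.ι_add 0 0
  rwa [add_zero, left_eq_mul] at this

theorem ι_eq_one {a : F} : Φ.ι a = 1 ↔ a = 0 := by
  rw [← Φ.ι_zero, Φ.ι_injective.eq_iff]

theorem ι_mul_ι (a b : F) : Φ.ι a * Φ.ι b = Φ.ι (a + b) := (Φ.ι_add a b).symm

theorem mul_ι_mul_ι (g : G) (a b : F) : g * Φ.ι a * Φ.ι b = g * Φ.ι (a + b) := by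
  rw [mul_assoc, ι_mul_ι]

theorem mul_ι_mul (g h : G) (a : F) : g * Φ.ι a * h = g * h * Φ.ι a := by
  rw [mul_assoc, ← Φ.ι_comm, mul_assoc]

include Φ in
theorem eq_of_add_eq_zero {a b : F} (h : a + b = 0) : a = b := by
  have := Φ.add_self b
  exact add_right_cancel (h.trans this.symm)

/-- Reordering the inner factor of `g(hg)h` shows that `q` is quadratic with polar form `B`. -/
theorem q_mul (g h : G) : Φ.q (g * h) = Φ.q g + Φ.q h + Φ.B h g := by
  apply Φ.ι_injective
  rw [← Φ.mul_self, Φ.ι_add, Φ.ι_add, ← Φ.mul_self, ← Φ.mul_self,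
    show g * h * (g * h) = g * (h * g) * h by group, Φ.mul_comm h g]
  simp only [← mul_assoc]
  rw [Φ.mul_ι_mul]

theorem B_comm (g h : G) : Φ.B g h = Φ.B h g := by
  apply Φ.eq_of_add_eq_zero
  apply Φ.ι_injective
  have := Φ.mul_comm g h
  rw [Φ.mul_comm h g, Φ.mul_ι_mul_ι, left_eq_mul] at this
  rw [add_comm, this, Φ.ι_zero]

theorem B_mul_left (g g' h : G) : Φ.B (g * g') h = Φ.B g h + Φ.B g' h := by
  apply Φ.ι_injective
  have h1 := Φ.mul_comm (g * g') h
  rw [mul_assoc, Φ.mul_comm g' h, ← mul_assoc, ← mul_assoc, Φ.mul_comm g h, Φ.mul_ι_mul,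
    Φ.mul_ι_mul_ι, mul_assoc h] at h1
  exact (mul_left_cancel h1).symm

theorem B_mul_right (g h h' : G) : Φ.B g (h * h') = Φ.B g h + Φ.B g h' := by
  rw [Φ.B_comm, B_mul_left, Φ.B_comm h, Φ.B_comm h']

theorem B_eq_zero_iff {g h : G} : Φ.B g h = 0 ↔ g * h = h * g := by
  rw [Φ.mul_comm g h, mul_eq_left, Φ.ι_eq_one]

@[simp]
theorem B_self (g : G) : Φ.B g g = 0 := Φ.B_eq_zero_iff.2 rfl

@[simp]
theorem B_ι_left (a : F) (g : G) : Φ.B (Φ.ι a) g = 0 := Φ.B_eq_zero_iff.2 (Φ.ι_comm a g).symm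

@[simp]
theorem B_ι_right (g : G) (a : F) : Φ.B g (Φ.ι a) = 0 := Φ.B_eq_zero_iff.2 (Φ.ι_comm a g)

@[simp]
theorem B_one_right (g : G) : Φ.B g 1 = 0 := Φ.B_eq_zero_iff.2 (by simp)

@[simp]
theorem q_ι (a : F) : Φ.q (Φ.ι a) = 0 := by
  apply Φ.ι_injective
  rw [← Φ.mul_self, Φ.ι_mul_ι, Φ.add_self]

@[simp]
theorem q_mul_ι (g : G) (a : F) : Φ.q (g * Φ.ι a) = Φ.q g := by
  simp [Φ.q_mul]

theorem inv_eq (g : G) : g⁻¹ = g * Φ.ι (Φ.q g) := by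
  rw [inv_eq_iff_mul_eq_one, ← mul_assoc, Φ.mul_self, Φ.ι_mul_ι, Φ.add_self, Φ.ι_zero]

theorem mul_ι_ne {a : F} (ha : a ≠ 0) (g : G) : g * Φ.ι a ≠ g := by
  rwa [Ne, mul_eq_left, Φ.ι_eq_one]

/-- Representatives for the pairs `{g, g * ι a}`. -/
theorem exists_pair_representatives [Finite G] {a : F} (ha : a ≠ 0) :
    ∃ P : G → Prop, ∀ g, P (g * Φ.ι a) ↔ ¬ P g := by
  obtain ⟨n, ⟨e⟩⟩ := Finite.exists_equiv_fin G
  refine ⟨fun g => e g < e (g * Φ.ι a), fun g => ?_⟩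
  have hne : e g ≠ e (g * Φ.ι a) := fun h => Φ.mul_ι_ne ha g (e.injective h).symm
  show e (g * Φ.ι a) < e (g * Φ.ι a * Φ.ι a) ↔ ¬ e g < e (g * Φ.ι a)
  rw [Φ.mul_ι_mul_ι, Φ.add_self, Φ.ι_zero, mul_one]
  exact ⟨fun h => h.le.not_gt, fun h => lt_of_le_of_ne (not_lt.1 h) hne.symm⟩

/-- Representatives for the pairs `{g, g * ι a}` that are closed under inversion where this is
possible. -/
theorem exists_symmetric_representatives [Finite G] {a : F} (ha : a ≠ 0) :
    ∃ P : G → Prop, (∀ g, Φ.q g ≠ a → (P (g * Φ.ι a) ↔ ¬ P g)) ∧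
      ∀ g, P (g * Φ.ι (Φ.q g)) ↔ P g := by
  obtain ⟨n, ⟨e⟩⟩ := Finite.exists_equiv_fin G
  -- `f` is a minimum over `{g, g⁻¹}`, hence inversion-invariant. This set is disjoint from its
  -- translate by `ι a` exactly when `q g ≠ a`.
  let f : G → Fin n := fun g => min (e g) (e (g * Φ.ι (Φ.q g)))
  have hf : ∀ g, f (g * Φ.ι (Φ.q g)) = f g := fun g => by
    simp only [f, Φ.q_mul_ι, Φ.mul_ι_mul_ι, Φ.add_self, Φ.ι_zero, mul_one]
    exact min_comm _ _
  refine ⟨fun g => f g < f (g * Φ.ι a), fun g hg => ?_, fun g => ?_⟩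
  · have hne : f g ≠ f (g * Φ.ι a) := by
      simp only [f, Φ.q_mul_ι]
      rw [Φ.mul_ι_mul_ι]
      have h1 : e g ≠ e (g * Φ.ι a) := fun h => Φ.mul_ι_ne ha g (e.injective h).symm
      have h2 : e g ≠ e (g * Φ.ι (a + Φ.q g)) := fun h => by
        have := e.injective h
        rw [left_eq_mul, Φ.ι_eq_one] at this
        exact hg (Φ.eq_of_add_eq_zero this).symm
      have h3 : e (g * Φ.ι (Φ.q g)) ≠ e (g * Φ.ι a) := fun h =>
        hg (Φ.ι_injective (mul_left_cancel (e.injective h)))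
      have h4 : e (g * Φ.ι (Φ.q g)) ≠ e (g * Φ.ι (a + Φ.q g)) := fun h => by
        have := Φ.ι_injective (mul_left_cancel (e.injective h))
        exact ha (right_eq_add.1 this)
      rcases min_choice (e g) (e (g * Φ.ι (Φ.q g))) with h5 | h5 <;>
      rcases min_choice (e (g * Φ.ι a)) (e (g * Φ.ι (a + Φ.q g))) with h6 | h6 <;>
      rw [h5, h6] <;> assumption
    show f (g * Φ.ι a) < f (g * Φ.ι a * Φ.ι a) ↔ ¬ f g < f (g * Φ.ι a)
    rw [Φ.mul_ι_mul_ι, Φ.add_self, Φ.ι_zero, mul_one]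
    exact ⟨fun h => h.le.not_gt, fun h => lt_of_le_of_ne (not_lt.1 h) hne.symm⟩
  · show f (g * Φ.ι (Φ.q g)) < f (g * Φ.ι (Φ.q g) * Φ.ι a) ↔ f g < f (g * Φ.ι a)
    rw [hf, Φ.mul_ι_mul]
    have := hf (g * Φ.ι a)
    rw [Φ.q_mul_ι] at this
    rw [this]

end CentralForm

theorem ZMod.two_eq_zero_or_one (a : ZMod 2) : a = 0 ∨ a = 1 := by
  revert a; decide

theorem ZMod.two_one_add_one : (1 : ZMod 2) + 1 = 0 := by decide

theorem ZMod.two_ne_one_iff {a : ZMod 2} : a ≠ 1 ↔ a = 0 := by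
  revert a; decide

/-! ### The obstruction from a quaternion subgroup -/

namespace CentralForm

variable {G : Type*} [Group G] (Φ : CentralForm G (ZMod 2))

/-- An element `X` of order 4 avoids `S ∪ SS` once certain involutions are excluded from `S`. -/
theorem not_isFilled_of_involutions_excluded [Finite G] {X Y : G} {T : Set G} (h₀ : IsProductFree (insert (Φ.ι 1) T))
    (hX : Φ.q X = 1) (hXY : Φ.B X Y = 1)
    (h : ∀ S, IsProductFree S → insert (Φ.ι 1) T ⊆ S → ∀ m ∈ S, Φ.q m = 0 → Φ.B X m = 1 →
      Φ.B Y m = 0 → False) : ¬ IsFilled G := by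
  have h10 : (1 : ZMod 2) ≠ 0 := by decide
  have hXX : X * X = Φ.ι 1 := by rw [Φ.mul_self, hX]
  refine not_isFilled_of_forall_extension h₀ (x := X) ?_ fun S hS hT => ?_
  · rintro rfl
    rw [one_mul, eq_comm, Φ.ι_eq_one] at hXX
    exact h10 hXX
  have hzS : Φ.ι 1 ∈ S := hT (Set.mem_insert _ _)
  have hq : ∀ s ∈ S, Φ.q s = 0 := fun s hs => by
    rcases ZMod.two_eq_zero_or_one (Φ.q s) with h1 | h1
    · exact h1
    · refine absurd hzS ?_
      rw [← h1, ← Φ.mul_self]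
      exact hS.mul_notMem hs hs
  refine ⟨fun hXS => h10 (by rw [← hX, hq X hXS]), ?_⟩
  -- If `X = mn` with `q m = q n = 0`, then `B m n = 1`, so neither factor commutes with `X`. Since
  -- `B X Y = 1`, one of them commutes with `Y`, which is the excluded type.
  rintro m hm n hn rfl
  rw [Φ.q_mul, hq m hm, hq n hn, zero_add, zero_add] at hX
  rw [Φ.B_mul_left] at hXY
  rcases ZMod.two_eq_zero_or_one (Φ.B m Y) with h1 | h1
  · refine h S hS hT m hm (hq m hm) ?_ (by rw [Φ.B_comm, h1])
    rw [Φ.B_mul_left, Φ.B_self, zero_add, hX]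
  · refine h S hS hT n hn (hq n hn) ?_ ?_
    · rw [Φ.B_mul_left, Φ.B_self, add_zero, Φ.B_comm, hX]
    · rw [Φ.B_comm]
      rw [h1] at hXY
      simpa using hXY

/-- If `X` and `Y` generate a quaternion group, and every element of order 4 in its centralizer
fails to commute with another such element, then `G` is not filled. -/
theorem not_isFilled_of_quaternion [Finite G] {X Y : G} (hX : Φ.q X = 1) (hY : Φ.q Y = 1)
    (hXY : Φ.B X Y = 1)
    (hF : ∀ u, Φ.q u = 1 → Φ.B X u = 0 → Φ.B Y u = 0 →
      ∃ u', Φ.q u' = 1 ∧ Φ.B X u' = 0 ∧ Φ.B Y u' = 0 ∧ Φ.B u u' = 1) : ¬ IsFilled G := by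
  have h11 := ZMod.two_one_add_one
  have h10 : (1 : ZMod 2) ≠ 0 := by decide
  have hYX : Φ.B Y X = 1 := by rw [Φ.B_comm, hXY]
  obtain ⟨P, hP⟩ := Φ.exists_pair_representatives h10
  set z := Φ.ι 1 with hz
  have hzz : z * z = 1 := by rw [hz, Φ.ι_mul_ι, h11, Φ.ι_zero]
  have hz1 : z ≠ 1 := by rw [hz, Ne, Φ.ι_eq_one]; exact h10
  -- `U` takes one of each pair `{u, uz}` of elements of order 4 centralizing `X` and `Y`. Members
  -- of `S₁` are involutions not commuting with `Y`, so their products commute with `Y` and leave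
  -- `S₁`; the choice by `P` prevents products equal to `z`.
  let U : Set G := {u | Φ.q u = 1 ∧ Φ.B X u = 0 ∧ Φ.B Y u = 0 ∧ P u}
  let S₁ : Set G := {g | ∃ u ∈ U, g = X * u ∨ g = X * Y * u}
  have hS₁ : ∀ g ∈ S₁, Φ.q g = 0 ∧ Φ.B Y g = 1 ∧ g * z ∉ S₁ := by
    rintro g ⟨u, ⟨hu, hXu, hYu, hPu⟩, rfl | rfl⟩
    · refine ⟨?_, ?_, ?_⟩
      · rw [Φ.q_mul, hX, hu, Φ.B_comm, hXu]; decide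
      · rw [Φ.B_mul_right, hYX, hYu, add_zero]
      · rintro ⟨v, ⟨hv, hXv, hYv, hPv⟩, h | h⟩
        · rw [mul_assoc] at h
          rw [← mul_left_cancel h] at hPv
          exact (hP u).1 hPv hPu
        · have := congrArg (Φ.B X) h
          simp [Φ.B_mul_right, hXu, hXY, hXv, hz] at this
    · refine ⟨?_, ?_, ?_⟩
      · rw [Φ.q_mul, Φ.q_mul, Φ.B_mul_right, hX, hY, hu, Φ.B_comm u, hXu, Φ.B_comm u, hYu, hYX]
        decide
      · rw [Φ.B_mul_right, Φ.B_mul_right, hYX, hYu, Φ.B_self, add_zero, add_zero]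
      · rintro ⟨v, ⟨hv, hXv, hYv, hPv⟩, h | h⟩
        · have := congrArg (Φ.B X) h
          simp [Φ.B_mul_right, hXu, hXY, hXv, hz] at this
        · rw [mul_assoc] at h
          rw [← mul_left_cancel h] at hPv
          exact (hP u).1 hPv hPu
  have h₀ : IsProductFree (insert z S₁) := by
    rw [isProductFree_iff]
    refine ⟨⟨z, Set.mem_insert _ _⟩, ?_⟩
    rintro a ha b hb hab
    rcases ha with rfl | ha
    · rcases hb with rfl | hb
      · rw [hzz] at hab
        rcases hab with h | h
        · exact hz1 h.symm
        · have := (hS₁ _ h).2.1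
          rw [Φ.B_one_right] at this
          exact h10 this.symm
      · rw [hz, ← Φ.ι_comm, ← hz] at hab
        rcases hab with h | h
        · rw [mul_eq_right] at h
          have := (hS₁ _ hb).2.1
          rw [h, Φ.B_one_right] at this
          exact h10 this.symm
        · exact (hS₁ b hb).2.2 h
    · rcases hb with rfl | hb
      · rcases hab with h | h
        · rw [mul_eq_right] at h
          have := (hS₁ _ ha).2.1
          rw [h, Φ.B_one_right] at this
          exact h10 this.symm
        · exact (hS₁ a ha).2.2 h
      · rcases hab with h | h
        · have hb' : b = a * z := by
            rw [← h, ← mul_assoc, Φ.mul_self, (hS₁ a ha).1, Φ.ι_zero, one_mul]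
          exact (hS₁ a ha).2.2 (hb' ▸ hb)
        · have := (hS₁ _ h).2.1
          rw [Φ.B_mul_right, (hS₁ a ha).2.1, (hS₁ b hb).2.1, h11] at this
          exact h10 this.symm
  have hYY : Y * Y = z := by rw [Φ.mul_self, hY]
  refine Φ.not_isFilled_of_involutions_excluded h₀ hX hXY ?_
  intro S hS hzS m hm hqm hXm hYm
  -- `m = Y * u` is incompatible with the chosen product-free set
  obtain ⟨u, rfl⟩ : ∃ u, m = Y * u := ⟨Y⁻¹ * m, by simp⟩
  rw [Φ.B_mul_right, hXY] at hXm
  have hXu : Φ.B X u = 0 := by simpa using hXm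
  have hYu : Φ.B Y u = 0 := by simpa [Φ.B_mul_right] using hYm
  have hu : Φ.q u = 1 := by
    rw [Φ.q_mul, hY, Φ.B_comm, hYu, add_zero] at hqm
    exact (Φ.eq_of_add_eq_zero hqm).symm
  obtain ⟨u', hPu', hu', hXu', hYu', huu'⟩ :
      ∃ u', P u' ∧ Φ.q u' = 1 ∧ Φ.B X u' = 0 ∧ Φ.B Y u' = 0 ∧ Φ.B u u' = 1 := by
    obtain ⟨u', h1, h2, h3, h4⟩ := hF u hu hXu hYu
    by_cases h : P u'
    · exact ⟨u', h, h1, h2, h3, h4⟩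
    · exact ⟨u' * z, (hP u').2 h, by simp [hz, h1], by simp [hz, Φ.B_mul_right, h2],
        by simp [hz, Φ.B_mul_right, h3], by simp [hz, Φ.B_mul_right, h4]⟩
  have hw : Φ.q (u * u') = 1 := by
    rw [Φ.q_mul, hu, hu', Φ.B_comm, huu']; decide
  have hXw : Φ.B X (u * u') = 0 := by rw [Φ.B_mul_right, hXu, hXu', add_zero]
  have hYw : Φ.B Y (u * u') = 0 := by rw [Φ.B_mul_right, hYu, hYu', add_zero]
  have huX : u * X = X * u := Φ.B_eq_zero_iff.1 (by rw [Φ.B_comm, hXu])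
  have huY : u * Y = Y * u := Φ.B_eq_zero_iff.1 (by rw [Φ.B_comm, hYu])
  have hYX' : Y * X = X * Y * z := by rw [Φ.mul_comm, hYX]
  have hcomm : ∀ g, z * g = g * z := fun g => (Φ.ι_comm _ _).symm
  -- One of `uu'`, `uu'z` is in `U`. Accordingly `(Yu)(XYu') = X(uu')` or `(Yu)(Xu') = XY(uu'z)` is
  -- a product of elements of `S` lying in `S`.
  by_cases hPw : P (u * u')
  · have h1 : X * Y * u' ∈ S := hzS (Or.inr ⟨u', ⟨hu', hXu', hYu', hPu'⟩, Or.inr rfl⟩)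
    have h2 : X * (u * u') ∈ S := hzS (Or.inr ⟨_, ⟨hw, hXw, hYw, hPw⟩, Or.inl rfl⟩)
    refine hS.mul_notMem hm h1 ?_
    have : Y * u * (X * Y * u') = X * (u * u') := by
      calc Y * u * (X * Y * u') = Y * (u * X) * Y * u' := by group
        _ = Y * X * (u * Y) * u' := by rw [huX]; group
        _ = X * Y * z * Y * u * u' := by rw [huY, hYX']; group
        _ = X * (Y * (z * Y)) * u * u' := by group
        _ = X * (z * z) * u * u' := by rw [hcomm, ← mul_assoc Y Y z, hYY]
        _ = X * (u * u') := by rw [hzz]; group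
    rwa [this]
  · have h1 : X * u' ∈ S := hzS (Or.inr ⟨u', ⟨hu', hXu', hYu', hPu'⟩, Or.inl rfl⟩)
    have h2 : X * Y * (u * u' * z) ∈ S := by
      refine hzS (Or.inr ⟨u * u' * z, ⟨?_, ?_, ?_, (hP _).2 hPw⟩, Or.inr rfl⟩)
      · rw [hz, Φ.q_mul_ι, hw]
      · rw [hz, Φ.B_mul_right, hXw, Φ.B_ι_right, add_zero]
      · rw [hz, Φ.B_mul_right, hYw, Φ.B_ι_right, add_zero]
    refine hS.mul_notMem hm h1 ?_
    have : Y * u * (X * u') = X * Y * (u * u' * z) := by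
      calc Y * u * (X * u') = Y * (u * X) * u' := by group
        _ = X * Y * (z * (u * u')) := by rw [huX, ← mul_assoc, hYX']; group
        _ = _ := by rw [hcomm]
    rwa [this]

end CentralForm

/-! ### Nondegenerate forms with values in `F₂` -/

namespace CentralForm

variable {G : Type*} [Group G] (Φ : CentralForm G (ZMod 2))

/-- The commutator form is nondegenerate modulo the image of `ι`. -/
def Nondegenerate {F : Type*} [AddCommGroup F] (Φ : CentralForm G F) : Prop :=
  ∀ g, (∀ h, Φ.B g h = 0) → g ∈ Set.range Φ.ι

variable {Φ}

theorem Nondegenerate.exists_eq_one (hΦ : Φ.Nondegenerate) {g : G} (hg : g ∉ Set.range Φ.ι) :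
    ∃ h, Φ.B g h = 1 := by
  by_contra! hne
  exact hg (hΦ g fun h => ZMod.two_ne_one_iff.1 (hne h))

/-- The functionals `B s` and `B s + B y` are nonzero. If neither witness is orthogonal to `y`,
their product is. -/
theorem Nondegenerate.exists_dual (hΦ : Φ.Nondegenerate) {s y : G} (hs : s ∉ Set.range Φ.ι)
    (hsy : s * y ∉ Set.range Φ.ι) : ∃ g, Φ.B s g = 1 ∧ Φ.B y g = 0 := by
  have h11 := ZMod.two_one_add_one
  obtain ⟨g₁, h₁⟩ := hΦ.exists_eq_one hs
  obtain ⟨g₂, h₂⟩ := hΦ.exists_eq_one hsy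
  rw [Φ.B_mul_left] at h₂
  rcases ZMod.two_eq_zero_or_one (Φ.B y g₁) with h₃ | h₃
  · exact ⟨g₁, h₁, h₃⟩
  rcases ZMod.two_eq_zero_or_one (Φ.B y g₂) with h₄ | h₄
  · exact ⟨g₂, by simpa [h₄] using h₂, h₄⟩
  · rw [h₄] at h₂
    refine ⟨g₁ * g₂, ?_, ?_⟩
    · rw [Φ.B_mul_right, h₁, add_comm, add_eq_right.1 h₂, zero_add]
    · rw [Φ.B_mul_right, h₃, h₄, h11]

/-- A group with nondegenerate form containing two commuting noncentral involutions whose product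
is noncentral is not filled. -/
theorem Nondegenerate.not_isFilled [Finite G] (hΦ : Φ.Nondegenerate) {s y : G}
    (hs : s ∉ Set.range Φ.ι) (hy : y ∉ Set.range Φ.ι) (hsy : s * y ∉ Set.range Φ.ι)
    (hqs : Φ.q s = 0) (hqy : Φ.q y = 0) (hB : Φ.B s y = 0) : ¬ IsFilled G := by
  have h11 := ZMod.two_one_add_one
  have hBys : Φ.B y s = 0 := by rw [Φ.B_comm, hB]
  -- Multiplying by `s` flips `q` but keeps the pairings with `s` and `y`, so `q s' = 1` can be
  -- arranged.
  obtain ⟨s', hss', hys', hqs'⟩ : ∃ s', Φ.B s s' = 1 ∧ Φ.B y s' = 0 ∧ Φ.q s' = 1 := by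
    obtain ⟨g, h1, h2⟩ := hΦ.exists_dual hs hsy
    rcases ZMod.two_eq_zero_or_one (Φ.q g) with h3 | h3
    · exact ⟨g * s, by simp [Φ.B_mul_right, h1], by simp [Φ.B_mul_right, h2, hBys],
        by simp [Φ.q_mul, h3, hqs, h1]⟩
    · exact ⟨g, h1, h2, h3⟩
  have hs's : Φ.B s' s = 1 := by rw [Φ.B_comm, hss']
  have hs'y : Φ.B s' y = 0 := by rw [Φ.B_comm, hys']
  obtain ⟨y', hyy', hsy', hs'y', hqy'⟩ :
      ∃ y', Φ.B y y' = 1 ∧ Φ.B s y' = 0 ∧ Φ.B s' y' = 0 ∧ Φ.q y' = 1 := by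
    obtain ⟨g, h1, h2, h3⟩ : ∃ g, Φ.B y g = 1 ∧ Φ.B s g = 0 ∧ Φ.B s' g = 0 := by
      have hys : y * s ∉ Set.range Φ.ι := by rwa [← Φ.B_eq_zero_iff.1 hB]
      obtain ⟨g, h1, h2⟩ := hΦ.exists_dual hy hys
      rcases ZMod.two_eq_zero_or_one (Φ.B s' g) with h3 | h3
      · exact ⟨g, h1, h2, h3⟩
      · exact ⟨g * s, by simp [Φ.B_mul_right, h1, hBys], by simp [Φ.B_mul_right, h2],
          by simp [Φ.B_mul_right, h3, hs's, h11]⟩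
    rcases ZMod.two_eq_zero_or_one (Φ.q g) with h4 | h4
    · exact ⟨g * y, by simp [Φ.B_mul_right, h1], by simp [Φ.B_mul_right, h2, hB],
        by simp [Φ.B_mul_right, h3, hs'y], by simp [Φ.q_mul, h4, hqy, h1]⟩
    · exact ⟨g, h1, h2, h3, h4⟩
  have hy'y : Φ.B y' y = 1 := by rw [Φ.B_comm, hyy']
  have hy's : Φ.B y' s = 0 := by rw [Φ.B_comm, hsy']
  have hy's' : Φ.B y' s' = 0 := by rw [Φ.B_comm, hs'y']
  -- This is `D₈ ∘ D₈ ≅ Q₈ ∘ Q₈`: the dihedral groups `⟨s, s'⟩` and `⟨y, y'⟩` are recombined into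
  -- the commuting quaternion groups `⟨s', Y⟩` and `⟨y', W⟩`.
  obtain ⟨Y, hY⟩ : ∃ Y, Y = s * y' := ⟨_, rfl⟩
  obtain ⟨W, hW⟩ : ∃ W, W = y * s' := ⟨_, rfl⟩
  have hqY : Φ.q Y = 1 := by simp [hY, Φ.q_mul, hqs, hqy', hy's]
  have hXY : Φ.B s' Y = 1 := by simp [hY, Φ.B_mul_right, hs's, hs'y']
  have hqW : Φ.q W = 1 := by simp [hW, Φ.q_mul, hqy, hqs', hs'y]
  have hVW : Φ.B y' W = 1 := by simp [hW, Φ.B_mul_right, hy'y, hy's']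
  have hXW : Φ.B s' W = 0 := by simp [hW, Φ.B_mul_right, hs'y]
  have hYV : Φ.B Y y' = 0 := by simp [hY, Φ.B_mul_left, hsy']
  have hYW : Φ.B Y W = 0 := by
    simp [hY, hW, Φ.B_mul_left, Φ.B_mul_right, hB, hss', hy'y, hy's', h11]
  refine Φ.not_isFilled_of_quaternion hqs' hqY hXY fun u hu hXu hYu => ?_
  have hune : u ∉ Set.range Φ.ι := by
    rintro ⟨c, rfl⟩
    simp at hu
  have huX : Φ.B u s' = 0 := by rw [Φ.B_comm, hXu]
  have huY : Φ.B u Y = 0 := by rw [Φ.B_comm, hYu]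
  obtain ⟨t, hut, hXt, hYt⟩ : ∃ t, Φ.B u t = 1 ∧ Φ.B s' t = 0 ∧ Φ.B Y t = 0 := by
    obtain ⟨g, hg⟩ := hΦ.exists_eq_one hune
    obtain ⟨g₁, hg1, hX1⟩ : ∃ g₁, Φ.B u g₁ = 1 ∧ Φ.B s' g₁ = 0 := by
      rcases ZMod.two_eq_zero_or_one (Φ.B s' g) with h | h
      · exact ⟨g, hg, h⟩
      · exact ⟨g * Y, by simp [Φ.B_mul_right, hg, huY], by simp [Φ.B_mul_right, h, hXY, h11]⟩
    rcases ZMod.two_eq_zero_or_one (Φ.B Y g₁) with h | h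
    · exact ⟨g₁, hg1, hX1, h⟩
    · have hYX : Φ.B Y s' = 1 := by rw [Φ.B_comm, hXY]
      exact ⟨g₁ * s', by simp [Φ.B_mul_right, hg1, huX], by simp [Φ.B_mul_right, hX1],
        by simp [Φ.B_mul_right, h, hYX, h11]⟩
  -- If `q t = 0` and `u` commutes with `y'` and `W`, correct `t` by an element of `⟨y', W⟩`: each
  -- of `y'`, `W`, `y'W` has `q = 1`, and one of them commutes with `t`.
  rcases ZMod.two_eq_zero_or_one (Φ.q t) with hqt | hqt
  swap
  · exact ⟨t, hqt, hXt, hYt, hut⟩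
  rcases ZMod.two_eq_zero_or_one (Φ.B u y') with huV | huV
  swap
  · exact ⟨y', hqy', hs'y', hYV, huV⟩
  rcases ZMod.two_eq_zero_or_one (Φ.B u W) with huW | huW
  swap
  · exact ⟨W, hqW, hXW, hYW, huW⟩
  rcases ZMod.two_eq_zero_or_one (Φ.B y' t) with hVt | hVt
  · exact ⟨t * y', by simp [Φ.q_mul, hqt, hqy', hVt], by simp [Φ.B_mul_right, hXt, hs'y'],
      by simp [Φ.B_mul_right, hYt, hYV], by simp [Φ.B_mul_right, hut, huV]⟩
  rcases ZMod.two_eq_zero_or_one (Φ.B W t) with hWt | hWt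
  · exact ⟨t * W, by simp [Φ.q_mul, hqt, hqW, hWt], by simp [Φ.B_mul_right, hXt, hXW],
      by simp [Φ.B_mul_right, hYt, hYW], by simp [Φ.B_mul_right, hut, huW]⟩
  have hWV : Φ.B W y' = 1 := by rw [Φ.B_comm, hVW]
  exact ⟨t * y' * W, by simp [Φ.q_mul, Φ.B_mul_right, hqt, hqy', hqW, hVt, hWt, hWV, h11],
    by simp [Φ.B_mul_right, hXt, hs'y', hXW], by simp [Φ.B_mul_right, hYt, hYV, hYW],
    by simp [Φ.B_mul_right, hut, huV, huW]⟩

end CentralForm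

/-! ### Forms with values in `F₂²` and only central involutions -/

namespace CentralForm

variable {G : Type*} [Group G] (Φ : CentralForm G (ZMod 2 × ZMod 2))

set_option synthInstance.maxHeartbeats 200000 in
set_option synthInstance.maxSize 2000 in
/-- A group of "semi-extraspecial" type with centre of order 4 is not filled if all its
involutions are central. -/
theorem not_isFilled_of_anisotropic [Finite G] (hq : ∀ g, Φ.q g = 0 → g ∈ Set.range Φ.ι)
    (hB : ∀ g, g ∉ Set.range Φ.ι → ∀ c, ∃ h, Φ.B g h = c) {x : G} (hx : x ∉ Set.range Φ.ι) :
    ¬ IsFilled G := by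
  obtain ⟨a, ha⟩ : ∃ a, a = Φ.q x := ⟨_, rfl⟩
  have ha0 : a ≠ 0 := fun h => hx (hq x (by rw [← ha, h]))
  have hB0 : ∀ g h, Φ.B g h ≠ 0 → Φ.q h ≠ 0 := fun g h h1 h2 => by
    obtain ⟨c, rfl⟩ := hq h h2
    exact h1 (Φ.B_ι_right _ _)
  have haa : Φ.ι a * Φ.ι a = 1 := by rw [Φ.ι_mul_ι, Φ.add_self, Φ.ι_zero]
  obtain ⟨P, hP, hP'⟩ := Φ.exists_symmetric_representatives ha0
  -- On `D` the map `q` agrees with the additive map `B x` and takes values in the nontrivial coset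
  -- of `{0, a}`. A product of two members has `B x` in `{0, a}`, so it is not in `D`.
  let D : Set G := {g | Φ.B x g = Φ.q g ∧ Φ.q g ≠ 0 ∧ Φ.q g ≠ a}
  have hD : ∀ g ∈ D, g * Φ.ι a ∈ D := by
    rintro g ⟨h1, h2, h3⟩
    refine ⟨?_, ?_, ?_⟩ <;> simp [Φ.B_mul_right, h1, h2, h3]
  let S₁ : Set G := {g | g ∈ D ∧ P g}
  have h1D : (1 : G) ∉ D := fun h => h.2.1 (by rw [← Φ.ι_zero, Φ.q_ι])
  have h₀ : IsProductFree (insert (Φ.ι a) S₁) := by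
    rw [isProductFree_iff]
    have aux : ∀ g ∈ S₁, g * Φ.ι a ∉ insert (Φ.ι a) S₁ := by
      rintro g hg (h | h)
      · rw [mul_eq_right] at h
        exact h1D (h ▸ hg.1)
      · exact (hP g hg.1.2.2).1 h.2 hg.2
    refine ⟨⟨_, Set.mem_insert _ _⟩, ?_⟩
    rintro g hg k hk hgk
    rcases hg with rfl | hg
    · rcases hk with rfl | hk
      · rw [haa] at hgk
        rcases hgk with h | h
        · exact ha0 (Φ.ι_eq_one.1 h.symm)
        · exact h1D h.1
      · rw [← Φ.ι_comm] at hgk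
        exact aux k hk hgk
    · rcases hk with rfl | hk
      · exact aux g hg hgk
      · rcases hgk with h | h
        · have hk' : k = g * Φ.ι (Φ.q g) * Φ.ι a := by
            rw [← Φ.inv_eq, ← h, inv_mul_cancel_left]
          have := hk.2
          rw [hk', hP _ (by rw [Φ.q_mul_ι]; exact hg.1.2.2), hP'] at this
          exact this hg.2
        · have h1 := h.1
          have h2 : Φ.q g + Φ.q k = Φ.q (g * k) := by
            rw [← hg.1.1, ← hk.1.1, ← h1.1, Φ.B_mul_right]
          have key : ∀ a u v : ZMod 2 × ZMod 2, a ≠ 0 → u ≠ 0 → u ≠ a → v ≠ 0 → v ≠ a →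
            u + v = 0 ∨ u + v = a := by decide
          rcases key a _ _ ha0 hg.1.2.1 hg.1.2.2 hk.1.2.1 hk.1.2.2 with h3 | h3
          · exact h1.2.1 (h2 ▸ h3)
          · exact h1.2.2 (h2 ▸ h3)
  refine not_isFilled_of_forall_extension h₀ (x := x) ?_ fun S hS hT => ?_
  · rintro rfl
    exact hx ⟨0, Φ.ι_zero⟩
  have hqS : ∀ s ∈ S, Φ.q s ≠ a := fun s hs h => by
    refine hS.mul_notMem hs hs ?_
    rw [Φ.mul_self, h]
    exact hT (Set.mem_insert _ _)
  refine ⟨fun hxS => hqS x hxS ha.symm, ?_⟩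
  rintro m hm n hn hmn
  have hPS : ∀ g ∈ D, P g → g ∈ S := fun g hg h => hT (Or.inr ⟨hg, h⟩)
  have hPS' : ∀ g ∈ D, ¬ P g → g * Φ.ι a ∈ S := fun g hg h =>
    hPS _ (hD g hg) ((hP g hg.2.2).2 h)
  -- two obstructions to `k, s ∈ S`
  have obs₁ : ∀ k ∈ S, ∀ s ∈ S, k * s ∈ D → Φ.B k s ≠ Φ.q (k * s) + a := by
    intro k hk s hs hks h
    have h1 : ¬ P (k * s) := fun h => hS.mul_notMem hk hs (hPS _ hks h)
    -- That is, `s * k = (k * s)⁻¹ * ι a`, on which `P` is opposite to its value at `k * s`.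
    have h2 : s * k = k * s * Φ.ι (Φ.q (k * s)) * Φ.ι a := by
      rw [Φ.mul_comm s k, Φ.B_comm, h, Φ.mul_ι_mul_ι]
    have h3 : s * k ∈ D := by
      rw [h2]
      refine hD _ ⟨?_, ?_, ?_⟩
      · rw [Φ.B_mul_right, Φ.B_ι_right, add_zero, Φ.q_mul_ι, hks.1]
      · rw [Φ.q_mul_ι]; exact hks.2.1
      · rw [Φ.q_mul_ι]; exact hks.2.2
    refine hS.mul_notMem hs hk (hPS _ h3 ?_)
    rw [h2, hP _ (by rw [Φ.q_mul_ι]; exact hks.2.2), hP']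
    exact h1
  have obs₂ : ∀ k ∈ S, ∀ s ∈ S, k * s ∈ D → Φ.q k + Φ.B k s ≠ a := by
    intro k hk s hs hks h
    have h1 : ¬ P (k * s) := fun h => hS.mul_notMem hk hs (hPS _ hks h)
    refine hS.mul_notMem (hPS' _ hks h1) hk ?_
    have : k * s * Φ.ι a * k = s := by
      rw [Φ.mul_comm k s, Φ.mul_ι_mul_ι, Φ.mul_ι_mul, mul_assoc s k k, Φ.mul_self,
        Φ.mul_ι_mul_ι, ← add_assoc, h, Φ.add_self, Φ.ι_zero, mul_one]
    rwa [this]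
  -- One of `g`, `gx` satisfies `q = B x`, because neither is central and so `q` vanishes on
  -- neither. A translate by `ι a` then lies in `S` if the element itself does not satisfy `P`;
  -- pairings with the centralizer of `x` are unchanged.
  have hex : ∀ g, Φ.B x g ≠ 0 → Φ.B x g ≠ a → ∃ s ∈ S, s ∈ D ∧ Φ.B x s = Φ.B x g ∧
      ∀ k, Φ.B x k = 0 → Φ.B k s = Φ.B k g := by
    have main : ∀ g ∈ D, ∃ s ∈ S, s ∈ D ∧ Φ.B x s = Φ.B x g ∧
        ∀ k, Φ.B x k = 0 → Φ.B k s = Φ.B k g := by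
      intro g hg
      by_cases h : P g
      · exact ⟨g, hPS g hg h, hg, rfl, fun _ _ => rfl⟩
      · exact ⟨_, hPS' g hg h, hD g hg, by simp [Φ.B_mul_right],
          fun k _ => by simp [Φ.B_mul_right]⟩
    intro g h0 h1
    by_cases h : Φ.q g = Φ.B x g
    · exact main g ⟨h.symm, by rwa [h], by rwa [h]⟩
    · have h2 : Φ.B x (g * x) = Φ.B x g := by simp [Φ.B_mul_right]
      have h3 : Φ.q (g * x) = Φ.q g + a + Φ.B x g := by rw [Φ.q_mul, ha]
      have h4 := hB0 x (g * x) (by rwa [h2])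
      have h5 := hB0 x g h0
      rw [h3] at h4
      have key : ∀ a u w : ZMod 2 × ZMod 2, a ≠ 0 → w ≠ 0 → w ≠ a → u ≠ 0 → u ≠ w →
        u + a + w ≠ 0 → u + a + w = w := by decide
      have h6 := key _ _ _ ha0 h0 h1 h5 h h4
      rw [← h3] at h6
      obtain ⟨s, hs, hs1, hs2, hs3⟩ :=
        main (g * x) ⟨by rw [h2, h6], by rwa [h6], by rwa [h6]⟩
      exact ⟨s, hs, hs1, by rw [hs2, h2], fun k hk => by
        rw [hs3 k hk, Φ.B_mul_right, Φ.B_comm k x, hk, add_zero]⟩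
  -- The cases are `t = 0`, `t = a` and neither. In the last one `q m`, `q n`, `t` all lie in the
  -- nontrivial coset of `{0, a}`, so their sum cannot be `a`.
  obtain ⟨t, ht⟩ : ∃ t, t = Φ.B m n := ⟨_, rfl⟩
  have hxm : Φ.B x m = t := by rw [← hmn, Φ.B_mul_left, Φ.B_self, zero_add, Φ.B_comm, ht]
  have hxn : Φ.B x n = t := by rw [← hmn, Φ.B_mul_left, Φ.B_self, add_zero, ht]
  have hqx : a = Φ.q m + Φ.q n + t := by rw [ha, ← hmn, Φ.q_mul, Φ.B_comm, ht]
  have hm0 : Φ.q m ≠ 0 := by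
    intro h
    obtain ⟨c, rfl⟩ := hq m h
    rw [Φ.B_ι_left] at ht
    rw [ht, Φ.q_ι, zero_add, add_zero] at hqx
    exact hqS n hn hqx.symm
  have hn0 : Φ.q n ≠ 0 := by
    intro h
    obtain ⟨c, rfl⟩ := hq n h
    rw [Φ.B_ι_right] at ht
    rw [ht, Φ.q_ι, add_zero, add_zero] at hqx
    exact hqS m hm hqx.symm
  have hms : ∀ s, Φ.B m s = Φ.B x s + Φ.B n s := by
    intro s
    rw [← hmn, Φ.B_mul_left, add_assoc, Φ.add_self, add_zero]
  have hma := hqS m hm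
  have hna := hqS n hn
  obtain ⟨p, hp⟩ : ∃ p, p = Φ.q n := ⟨_, rfl⟩
  rw [← hp] at hqx hn0 hna
  by_cases ht0 : t = 0
  · have hqm : Φ.q m = p + a := by
      rw [hqx, ht0, add_zero, add_comm (Φ.q m), ← add_assoc, Φ.add_self, zero_add]
    have hxn0 : Φ.B x n = 0 := by rw [hxn, ht0]
    have hpa0 : p + a ≠ 0 := fun h => hna (Φ.eq_of_add_eq_zero h)
    have hpaa : p + a ≠ a := fun h => hn0 (add_eq_right.1 h)
    -- The two claims fix `B n` on the fibres of `B x` over `p + a` and `p`. Translating by `g₁`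
    -- covers the other two fibres, so `B n` never takes the value `a`, contrary to surjectivity.
    have claim₁ : ∀ g, Φ.B x g = p + a → Φ.B n g = 0 := by
      intro g hg
      obtain ⟨s, hs, hsD, hxs, hns⟩ := hex g (by rwa [hg]) (by rwa [hg])
      rw [← hns n hxn0]
      rw [hg] at hxs
      have hqs : Φ.q s = p + a := by rw [← hsD.1, hxs]
      obtain ⟨r, hr⟩ : ∃ r, r = Φ.B n s := ⟨_, rfl⟩
      have h1 := hB0 x (n * s) (by rwa [Φ.B_mul_right, hxn0, hxs, zero_add])
      have h2 := hB0 x (m * s) (by rwa [Φ.B_mul_right, hxm, ht0, hxs, zero_add])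
      have h3 := obs₁ n hn s hs
      have h4 : n * s ∈ D ↔ p + a = Φ.q (n * s) ∧ Φ.q (n * s) ≠ 0 ∧ Φ.q (n * s) ≠ a := by
        show Φ.B x (n * s) = _ ∧ _ ↔ _
        rw [Φ.B_mul_right, hxn0, hxs, zero_add]
      rw [h4] at h3
      rw [Φ.q_mul, Φ.B_comm s, ← hr, ← hp, hqs] at h1 h3
      rw [Φ.q_mul, Φ.B_comm s, hms, hqm, hqs, hxs, ← hr] at h2
      rw [← hr]
      have key : ∀ a p r : ZMod 2 × ZMod 2, a ≠ 0 → p ≠ 0 → p ≠ a → p + (p + a) + r ≠ 0 →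
        p + a + (p + a) + (p + a + r) ≠ 0 →
        ((p + a = p + (p + a) + r ∧ p + (p + a) + r ≠ 0 ∧ p + (p + a) + r ≠ a) →
          r ≠ p + (p + a) + r + a) → r = 0 := by decide
      exact key a p r ha0 hn0 hna h1 h2 h3
    have claim₂ : ∀ g, Φ.B x g = p → Φ.B n g = p := by
      intro g hg
      obtain ⟨s, hs, hsD, hxs, hns⟩ := hex g (by rwa [hg]) (by rwa [hg])
      rw [← hns n hxn0]
      rw [hg] at hxs
      have hqs : Φ.q s = p := by rw [← hsD.1, hxs]
      obtain ⟨r, hr⟩ : ∃ r, r = Φ.B n s := ⟨_, rfl⟩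
      have h1 := hB0 x (n * s) (by rwa [Φ.B_mul_right, hxn0, hxs, zero_add])
      have h2 := hB0 x (m * s) (by rwa [Φ.B_mul_right, hxm, ht0, hxs, zero_add])
      have h3 := obs₁ m hm s hs
      have h4 : m * s ∈ D ↔ p = Φ.q (m * s) ∧ Φ.q (m * s) ≠ 0 ∧ Φ.q (m * s) ≠ a := by
        show Φ.B x (m * s) = _ ∧ _ ↔ _
        rw [Φ.B_mul_right, hxm, ht0, hxs, zero_add]
      rw [h4] at h3
      rw [Φ.q_mul, Φ.B_comm s, ← hr, ← hp, hqs] at h1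
      rw [Φ.q_mul, Φ.B_comm s, hms, hqm, hqs, hxs, ← hr] at h2 h3
      rw [← hr]
      have key : ∀ a p r : ZMod 2 × ZMod 2, a ≠ 0 → p ≠ 0 → p ≠ a → p + p + r ≠ 0 →
        p + a + p + (p + r) ≠ 0 →
        ((p = p + a + p + (p + r) ∧ p + a + p + (p + r) ≠ 0 ∧ p + a + p + (p + r) ≠ a) →
          p + r ≠ p + a + p + (p + r) + a) → r = p := by decide
      exact key a p r ha0 hn0 hna h1 h2 h3
    obtain ⟨g, hg⟩ := hB n (fun ⟨c, hc⟩ => hn0 (by rw [hp, ← hc, Φ.q_ι])) a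
    obtain ⟨g₁, hg₁⟩ := hB x hx (p + a)
    have h1 := claim₁ g
    have h2 := claim₂ g
    have h3 := claim₁ (g * g₁)
    have h4 := claim₂ (g * g₁)
    rw [Φ.B_mul_right, Φ.B_mul_right, claim₁ g₁ hg₁, hg₁] at h3 h4
    rw [hg] at h1 h2 h3 h4
    have key : ∀ a p v : ZMod 2 × ZMod 2, a ≠ 0 → p ≠ 0 → p ≠ a → (v = p + a → a = 0) →
      (v = p → a = p) → (v + (p + a) = p + a → a + 0 = 0) → (v + (p + a) = p → a + 0 = p) →
      False := by decide
    exact key a p _ ha0 hn0 hna h1 h2 h3 h4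
  · by_cases hta : t = a
    · have hqm : Φ.q m = p := by
        rw [hta, right_eq_add] at hqx
        exact Φ.eq_of_add_eq_zero hqx
      -- For `s` with `B x s = q s = p`, nonvanishing of `q` and `obs₂` for both `n` and `m` leave
      -- no possible value of `B n s`.
      obtain ⟨g, hg⟩ := hB x hx p
      obtain ⟨s, hs, hsD, hxs, -⟩ := hex g (by rwa [hg]) (by rwa [hg])
      rw [hg] at hxs
      have hqs : Φ.q s = p := by rw [← hsD.1, hxs]
      obtain ⟨r, hr⟩ : ∃ r, r = Φ.B n s := ⟨_, rfl⟩
      have hap : a + p ≠ 0 := fun h => hna (Φ.eq_of_add_eq_zero h).symm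
      have hxns : Φ.B x (n * s) = a + p := by rw [Φ.B_mul_right, hxn, hta, hxs]
      have hxms : Φ.B x (m * s) = a + p := by rw [Φ.B_mul_right, hxm, hta, hxs]
      have h1 := hB0 x (n * s) (by rwa [hxns])
      have h2 := hB0 x (n * x * s) (by
        rwa [Φ.B_mul_right, Φ.B_mul_right, Φ.B_self, add_zero, hxn, hta, hxs])
      have h3 := obs₂ n hn s hs
      have h4 := obs₂ m hm s hs
      have h5 : n * s ∈ D ↔ a + p = Φ.q (n * s) ∧ Φ.q (n * s) ≠ 0 ∧ Φ.q (n * s) ≠ a := by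
        show Φ.B x (n * s) = _ ∧ _ ↔ _
        rw [hxns]
      have h6 : m * s ∈ D ↔ a + p = Φ.q (m * s) ∧ Φ.q (m * s) ≠ 0 ∧ Φ.q (m * s) ≠ a := by
        show Φ.B x (m * s) = _ ∧ _ ↔ _
        rw [hxms]
      rw [h5] at h3
      rw [h6] at h4
      rw [Φ.q_mul, Φ.B_comm s, ← hr, ← hp, hqs] at h1 h3
      rw [Φ.q_mul, Φ.B_comm s, hms, hqm, hqs, hxs, ← hr] at h4
      rw [Φ.q_mul, Φ.q_mul, Φ.B_comm s, Φ.B_mul_left, ← hr, hxn, hta, hxs, ← ha, ← hp, hqs] at h2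
      have key : ∀ a p r : ZMod 2 × ZMod 2, a ≠ 0 → p ≠ 0 → p ≠ a → p + p + r ≠ 0 →
        p + a + a + p + (r + p) ≠ 0 →
        ((a + p = p + p + r ∧ p + p + r ≠ 0 ∧ p + p + r ≠ a) → p + r ≠ a) →
        ((a + p = p + p + (p + r) ∧ p + p + (p + r) ≠ 0 ∧ p + p + (p + r) ≠ a) →
          p + (p + r) ≠ a) → False := by decide
      exact key a p r ha0 hn0 hna h1 h2 h3 h4
    · have key : ∀ a p u t : ZMod 2 × ZMod 2, a ≠ 0 → p ≠ 0 → p ≠ a → u ≠ 0 → u ≠ a → t ≠ 0 →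
        t ≠ a → a ≠ u + p + t := by decide
      exact key a p _ t ha0 hn0 hna hm0 hma ht0 hta hqx

end CentralForm

/-! ### Groups of order 16 and maximal class -/

/-- Multiplication of normal forms `r ^ i * t ^ j`, where `t * r = r ^ e * t`, `r ^ 8 = 1` and
`t * t = r ^ c`. -/
def normalFormMul (e c : ZMod 8) (a b : ZMod 8 × ZMod 2) : ZMod 8 × ZMod 2 :=
  (a.1 + (if a.2 = 0 then b.1 else e * b.1) + (if a.2 = 1 ∧ b.2 = 1 then c else 0), a.2 + b.2)

/-- The dihedral, semidihedral and generalized quaternion groups of order 16 are not filled. -/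
theorem not_isFilled_of_normalForm {G : Type*} [Group G] [Finite G]
    (f : ZMod 8 × ZMod 2 → G) (hf : Function.Bijective f) {e c : ZMod 8} (he : e = 3 ∨ e = 7)
    (hc : c = 0 ∨ c = 4) (hmul : ∀ a b, f a * f b = f (normalFormMul e c a b)) :
    ¬ IsFilled G := by
  -- In normal form this is `{r², r⁷, t, r⁴t}`. It is locally maximal for all four choices of `(e,
  -- c)`, and `r³` lies in neither it nor its square.
  let L : Finset (ZMod 8 × ZMod 2) := {(2, 0), (7, 0), (0, 1), (4, 1)}
  have key₁ : ∀ a ∈ L, ∀ b ∈ L, normalFormMul e c a b ∉ L := by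
    rcases he with rfl | rfl <;> rcases hc with rfl | rfl <;> decide
  have key₂ : ∀ p, p ∉ L → normalFormMul e c p p ∈ L ∨ ∃ a ∈ L, normalFormMul e c p a ∈ L ∨
      normalFormMul e c a p ∈ L ∨ ∃ b ∈ L, normalFormMul e c a b = p := by
    rcases he with rfl | rfl <;> rcases hc with rfl | rfl <;> decide
  have key₃ : ∀ a ∈ L, ∀ b ∈ L, normalFormMul e c a b ≠ (3, 0) := by
    rcases he with rfl | rfl <;> rcases hc with rfl | rfl <;> decide
  have hone : f (0, 0) = 1 := by
    have := hmul (0, 0) (0, 0)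
    have h0 : normalFormMul e c (0, 0) (0, 0) = (0, 0) := by simp [normalFormMul]
    rwa [h0, mul_eq_left] at this
  have h₀ : IsProductFree (f '' L) := by
    rw [isProductFree_iff]
    refine ⟨⟨f (2, 0), (2, 0), by simp [L], rfl⟩, ?_⟩
    rintro _ ⟨a, ha, rfl⟩ _ ⟨b, hb, rfl⟩ ⟨d, hd, h⟩
    rw [hmul] at h
    exact key₁ a ha b hb (hf.1 h ▸ hd)
  refine not_isFilled_of_forall_extension h₀ (x := f (3, 0)) ?_ fun S hS hT => ?_
  · rw [← hone]
    exact fun h => absurd (hf.1 h) (by decide)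
  have hL : ∀ p ∈ L, f p ∈ S := fun p hp => hT ⟨p, hp, rfl⟩
  have hSL : ∀ p, f p ∈ S → p ∈ L := by
    intro p hp
    by_contra hpL
    rcases key₂ p hpL with h | ⟨a, ha, h | h | ⟨b, hb, rfl⟩⟩
    · exact hS.mul_notMem hp hp (hmul p p ▸ hL _ h)
    · exact hS.mul_notMem hp (hL a ha) (hmul p a ▸ hL _ h)
    · exact hS.mul_notMem (hL a ha) hp (hmul a p ▸ hL _ h)
    · exact hS.mul_notMem (hL a ha) (hL b hb) (hmul a b ▸ hp)
  refine ⟨fun h => absurd (hSL _ h) (by decide), ?_⟩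
  intro m hm n hn hmn
  obtain ⟨a, rfl⟩ := hf.2 m
  obtain ⟨b, rfl⟩ := hf.2 n
  rw [hmul] at hmn
  exact key₃ a (hSL a hm) b (hSL b hn) (hf.1 hmn)

/-- A group `⟨r⟩ ∪ ⟨r⟩ t` with `r` of order 8 inverted or sent to its cube by `t` is not filled. -/
theorem not_isFilled_of_maximal_class {G : Type*} [Group G] [Finite G] {r t : G} {e c : ZMod 8}
    (he : e = 3 ∨ e = 7) (hc : c = 0 ∨ c = 4) (hr : r ^ 4 ≠ 1) (hr8 : r ^ 8 = 1)
    (hrt : t * r = r ^ e.val * t) (htt : t * t = r ^ c.val) (ht : ∀ k : ℕ, t ≠ r ^ k)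
    (hG : ∀ g : G, ∃ k : ℕ, g = r ^ k ∨ g = r ^ k * t) : ¬ IsFilled G := by
  let ρ : ZMod 8 → G := fun i => r ^ i.val
  have hρ : ∀ k : ℕ, r ^ k = ρ k := fun k => by
    simp only [ρ, ZMod.val_natCast]
    exact pow_eq_pow_mod k hr8
  have hρadd : ∀ i k, ρ (i + k) = ρ i * ρ k := fun i k => by
    have : ρ i * ρ k = r ^ (i.val + k.val) := (pow_add _ _ _).symm
    rw [this, hρ]
    simp
  have htρ : ∀ k, t * ρ k = ρ (e * k) * t := fun k => by
    have h1 : SemiconjBy t r (r ^ e.val) := hrt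
    have h2 := (h1.pow_right k.val).eq
    rw [← pow_mul, hρ (e.val * k.val)] at h2
    simpa [ρ] using h2
  have htt' : t * t = ρ c := htt
  have h40 : ∀ i, ρ i = 1 → i = 0 := by
    intro i hi
    -- A nonzero residue mod 8 becomes 4 after at most two doublings.
    have hne : ∀ i : ZMod 8, i ≠ 0 → i = 4 ∨ i + i = 4 ∨ i + i + (i + i) = 4 := by decide
    have h4 : ρ 4 ≠ 1 := hr
    by_contra h
    rcases hne i h with h | h | h
    · exact h4 (h ▸ hi)
    · refine h4 ?_
      rw [← h, hρadd, hi, one_mul]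
    · refine h4 ?_
      rw [← h, hρadd, hρadd, hi, one_mul, one_mul]
  have hinj : ∀ i k, ρ i = ρ k → i = k := by
    intro i k h
    have h1 : ρ (i - k) * ρ k = ρ k := by rw [← hρadd, sub_add_cancel, h]
    exact sub_eq_zero.1 (h40 _ (mul_eq_right.1 h1))
  have htρne : ∀ i, t ≠ ρ i := fun i => ht i.val
  let f : ZMod 8 × ZMod 2 → G := fun p => if p.2 = 0 then ρ p.1 else ρ p.1 * t
  have hne : ∀ i k, ρ i ≠ ρ k * t := by
    intro i k h
    refine htρne (i - k) ?_
    have h1 : ρ k * t = ρ k * ρ (i - k) := by rw [← h, ← hρadd, add_sub_cancel]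
    exact mul_left_cancel h1
  have h01 : ∀ j : ZMod 2, j = 0 ∨ j = 1 := ZMod.two_eq_zero_or_one
  have h10 : (1 : ZMod 2) ≠ 0 := by decide
  have h11 := ZMod.two_one_add_one
  refine not_isFilled_of_normalForm f ⟨?_, ?_⟩ he hc ?_
  · rintro ⟨i, j⟩ ⟨k, l⟩ h
    rcases h01 j with rfl | rfl <;> rcases h01 l with rfl | rfl <;>
      simp only [f, h10, if_true, if_false] at h
    · rw [hinj _ _ h]
    · exact absurd h (hne _ _)
    · exact absurd h.symm (hne _ _)
    · rw [hinj _ _ (mul_right_cancel h)]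
  · intro g
    obtain ⟨k, rfl | rfl⟩ := hG g
    · exact ⟨(k, 0), by simp only [f, if_true, hρ]⟩
    · exact ⟨(k, 1), by simp only [f, h10, if_false, hρ]⟩
  · rintro ⟨i, j⟩ ⟨k, l⟩
    rcases h01 j with rfl | rfl <;> rcases h01 l with rfl | rfl <;>
      simp only [f, normalFormMul, h10, h10.symm, h11, if_true, if_false, zero_add, add_zero,
        and_self, and_true, and_false, hρadd]
    · rw [mul_assoc]
    · rw [mul_assoc, htρ, ← mul_assoc]
    · rw [mul_assoc (ρ i), ← mul_assoc t, htρ, mul_assoc (ρ (e * k)), htt', ← mul_assoc]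

/-! ### Hyperplanes and extraspecial groups -/

section Extraspecial

variable {G : Type*} [Group G]

/-- A vector space over the field with two elements has enough hyperplanes. -/
theorem exists_hyperplane [Finite G] (P : Subgroup G) (hsq : ∀ g : G, g * g ∈ P)
    (hcomm : ∀ g h : G, g * h * g⁻¹ * h⁻¹ ∈ P) {y : G} (hy : y ∉ P) :
    ∃ K : Subgroup G, P ≤ K ∧ y ∉ K ∧ ∀ g, g ∉ K → y * g ∈ K := by
  obtain ⟨K, hPK, hK⟩ :=
    (Set.toFinite {K : Subgroup G | P ≤ K ∧ y ∉ K}).exists_le_maximal ⟨le_rfl, hy⟩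
  refine ⟨K, hPK, hK.1.2, fun g hg => ?_⟩
  have hn : ∀ k ∈ K, ∀ g, g * k * g⁻¹ ∈ K := fun k hk g => by
    have := K.mul_mem (hPK (hcomm g k)) hk
    rwa [inv_mul_cancel_right] at this
  have hg2 : g * g ∈ K := hPK (hsq g)
  have hcomm' : ∀ h h' : G, h * h' ∈ K → h' * h ∈ K := fun h h' hh => by
    have := hn _ hh h⁻¹
    rwa [inv_inv, inv_mul_cancel_left] at this
  -- `M = K ∪ Kg⁻¹` properly contains `K`, so maximality of `K` forces `y ∈ M`.
  let M : Subgroup G :=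
    { carrier := {h | h ∈ K ∨ h * g ∈ K}
      one_mem' := Or.inl K.one_mem
      mul_mem' := by
        rintro a b (ha | ha) (hb | hb)
        · exact Or.inl (K.mul_mem ha hb)
        · exact Or.inr (by rw [mul_assoc]; exact K.mul_mem ha hb)
        · refine Or.inr (hcomm' _ _ ?_)
          rw [← mul_assoc]
          exact K.mul_mem (hcomm' _ _ ha) hb
        · refine Or.inl (hcomm' _ _ ?_)
          have := K.mul_mem (K.mul_mem hb (K.inv_mem hg2)) (hcomm' _ _ ha)
          have h2 : b * g * (g * g)⁻¹ * (g * a) = b * a := by group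
          rwa [h2] at this
      inv_mem' := by
        rintro a (ha | ha)
        · exact Or.inl (K.inv_mem ha)
        · refine Or.inr (hcomm' _ _ ?_)
          have := K.mul_mem hg2 (K.inv_mem ha)
          have h2 : g * g * (a * g)⁻¹ = g * a⁻¹ := by group
          rwa [h2] at this }
  have hKM : K ≤ M := fun h hh => Or.inl hh
  have hyM : y ∈ M := by
    by_contra hyM
    exact hg (hK.2 ⟨hPK.trans hKM, hyM⟩ hKM (Or.inr hg2 : g ∈ M))
  exact hyM.resolve_left hK.1.2

theorem isCoatom_of_hyperplane {K : Subgroup G} {y : G} (hy : y ∉ K)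
    (hK : ∀ g, g ∉ K → y * g ∈ K) : IsCoatom K := by
  refine ⟨fun h => hy (h ▸ Subgroup.mem_top y), fun M hKM => ?_⟩
  obtain ⟨g, hgM, hgK⟩ := SetLike.exists_of_lt hKM
  have hyM : y ∈ M := (Subgroup.mul_mem_cancel_right M hgM).1 (hKM.le (hK g hgK))
  refine eq_top_iff.2 fun h _ => ?_
  by_cases hh : h ∈ K
  · exact hKM.le hh
  · exact (Subgroup.mul_mem_cancel_left M hyM).1 (hKM.le (hK h hh))

theorem commutator_le_of_forall (P : Subgroup G) (h : ∀ a b : G, a * b * a⁻¹ * b⁻¹ ∈ P) :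
    commutator G ≤ P := by
  rw [commutator_def, Subgroup.commutator_le]
  intro a _ b _
  exact h a b

/-- A criterion for being extraspecial. -/
theorem isExtraspecialTwo_of_center [Finite G] (hG : IsPGroup 2 G) {z : G} (hz : z ≠ 1)
    (hzz : z * z = 1) (hcenter : ∀ g : G, g ∈ Subgroup.center G ↔ g = 1 ∨ g = z)
    (hsq : ∀ g : G, g * g = 1 ∨ g * g = z) (hcomm : ∀ g h : G, g * h = h * g ∨ g * h = h * g * z)
    (hex : ∃ g : G, g * g = z) : IsExtraspecialTwo G := by
  obtain ⟨g, hg⟩ := hex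
  have hsq' : ∀ g : G, g * g ∈ Subgroup.center G := fun g => (hcenter _).2 (hsq g)
  have hzc : ∀ g, g * z = z * g := Subgroup.mem_center_iff.1 ((hcenter z).2 (Or.inr rfl))
  have hcomm' : ∀ g h : G, g * h * g⁻¹ * h⁻¹ ∈ Subgroup.center G := fun g h => by
    rw [hcenter]
    rcases hcomm g h with h1 | h1
    · left; rw [h1]; group
    · right; rw [h1, hzc]; group
  have hgc : g ∉ Subgroup.center G := by
    rw [hcenter]
    rintro (rfl | rfl)
    · exact hz (by simpa using hg.symm)
    · exact hz (by simpa using hg)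
  have h1 : commutator G = Subgroup.center G := by
    refine le_antisymm (commutator_le_of_forall _ hcomm') fun c hc => ?_
    rw [Subgroup.mem_center_iff] at hgc
    push Not at hgc
    obtain ⟨h, hh⟩ := hgc
    have hz' : ⁅h, g⁆ = z := by
      rw [commutatorElement_def, (hcomm h g).resolve_left hh, hzc]; group
    rcases (hcenter c).1 hc with rfl | rfl
    · exact Subgroup.one_mem _
    · rw [← hz', commutator_def]
      exact Subgroup.commutator_mem_commutator (Subgroup.mem_top _) (Subgroup.mem_top _)
  have h2 : frattini G = Subgroup.center G := by
    apply le_antisymm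
    · intro y hy
      by_contra hyc
      obtain ⟨K, -, hyK, hK⟩ := exists_hyperplane _ hsq' hcomm' hyc
      exact hyK (frattini_le_coatom (isCoatom_of_hyperplane hyK hK) hy)
    -- `z` is a square: if a maximal `M` missed `z`, then `G = M⟨z⟩` and `g = m * z ^ k` would give
    -- `z = g² = m² ∈ M`.
    · have hzM : ∀ M : Subgroup G, IsCoatom M → z ∈ M := by
        intro M hM
        by_contra hzM
        have hMz : M < M ⊔ Subgroup.zpowers z := by
          refine lt_of_le_of_ne le_sup_left fun h => hzM ?_
          rw [h]
          exact le_sup_right (a := M) (Subgroup.mem_zpowers z)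
        have htop := hM.2 _ hMz
        have : (Subgroup.zpowers z).Normal := by
          refine ⟨fun n hn g => ?_⟩
          obtain ⟨k, rfl⟩ := Subgroup.mem_zpowers_iff.1 hn
          have : Commute g (z ^ k) := (show Commute g z from hzc g).zpow_right k
          rw [this.eq, mul_inv_cancel_right]
          exact hn
        have hgM : g ∈ M ⊔ Subgroup.zpowers z := htop ▸ Subgroup.mem_top g
        obtain ⟨m, hm, w, hw, rfl⟩ := Subgroup.mem_sup_of_normal_right.1 hgM
        obtain ⟨k, rfl⟩ := Subgroup.mem_zpowers_iff.1 hw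
        have hc : Commute m (z ^ k) := (show Commute m z from hzc m).zpow_right k
        have h3 : m * z ^ k * (m * z ^ k) = m * m := by
          calc m * z ^ k * (m * z ^ k) = m * m * (z ^ k * z ^ k) := by
                rw [mul_assoc, ← mul_assoc _ m, ← hc.eq]; group
            _ = m * m := by
                rw [← (Commute.refl z).mul_zpow, hzz, one_zpow, mul_one]
        rw [h3] at hg
        exact hzM (hg ▸ M.mul_mem hm hm)
      intro c hc
      rw [frattini, Order.radical]
      simp only [Subgroup.mem_iInf]
      intro M hM
      rcases (hcenter c).1 hc with rfl | rfl
      · exact M.one_mem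
      · exact hzM M hM
  refine ⟨inferInstance, hG, h1.symm, h1.trans h2.symm, ⟨?_⟩⟩
  have hcard : Nat.card (frattini G) = 2 := by
    have h3 : ((frattini G : Subgroup G) : Set G) = {1, z} := by
      rw [h2]
      ext c
      exact hcenter c
    rw [← SetLike.coe_sort_coe, h3, Nat.card_coe_set_eq, Set.ncard_pair hz.symm]
  have : Fact (Nat.Prime 2) := ⟨Nat.prime_two⟩
  exact mulEquivOfPrimeCardEq (p := 2) hcard (by simp)

theorem IsExtraspecialTwo.exists_central_involution (h : IsExtraspecialTwo G) :
    ∃ z : G, z ≠ 1 ∧ z * z = 1 ∧ (∀ g : G, g ∈ Subgroup.center G ↔ g = 1 ∨ g = z) ∧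
      (∀ g h : G, g * h = h * g ∨ g * h = h * g * z) ∧ ∀ g : G, g * g = 1 ∨ g * g = z := by
  have hcf : Subgroup.center G = frattini G :=
    h.center_eq_commutator.trans h.commutator_eq_frattini
  have hcard : Nat.card (Subgroup.center G) = 2 := by
    rw [hcf]
    obtain ⟨e⟩ := h.frattini_equiv
    rw [Nat.card_congr e.toEquiv]
    simp
  obtain ⟨z, hz, hzc⟩ : ∃ z : G, z ≠ 1 ∧ ∀ g : G, g ∈ Subgroup.center G ↔ g = 1 ∨ g = z := by
    have h2 : (Subgroup.center G : Set G).ncard = 2 := hcard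
    obtain ⟨a, b, hab, hs⟩ := Set.ncard_eq_two.1 h2
    have hmem : ∀ g : G, g ∈ Subgroup.center G ↔ g = a ∨ g = b := fun g => by
      rw [← SetLike.mem_coe, hs]; rfl
    rcases (hmem 1).1 (Subgroup.one_mem _) with rfl | rfl
    · exact ⟨b, hab.symm, hmem⟩
    · exact ⟨a, hab, fun g => (hmem g).trans or_comm⟩
  have hz_mem : z ∈ Subgroup.center G := (hzc z).2 (Or.inr rfl)
  have hzcomm : ∀ g, g * z = z * g := Subgroup.mem_center_iff.1 hz_mem
  have hzz : z * z = 1 := by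
    rcases (hzc _).1 (Subgroup.mul_mem _ hz_mem hz_mem) with h1 | h1
    · exact h1
    · exact absurd (mul_eq_left.1 h1) hz
  have hcomm : ∀ g h : G, g * h = h * g ∨ g * h = h * g * z := fun a b => by
    have h1 : ⁅a, b⁆ ∈ Subgroup.center G := by
      rw [h.center_eq_commutator, commutator_def]
      exact Subgroup.commutator_mem_commutator (Subgroup.mem_top _) (Subgroup.mem_top _)
    have h2 : a * b = ⁅a, b⁆ * (b * a) := by rw [commutatorElement_def]; group
    rcases (hzc _).1 h1 with h3 | h3
    · left; rw [h2, h3, one_mul]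
    · right; rw [h2, h3, ← hzcomm]
  -- Moving `k` past `g²` costs at most `z² = 1`, so squares are central.
  refine ⟨z, hz, hzz, hzc, hcomm, fun g => (hzc _).1 ?_⟩
  rw [Subgroup.mem_center_iff]
  intro k
  rcases hcomm k g with h1 | h1
  · rw [← mul_assoc, h1, mul_assoc, h1, mul_assoc]
  · rw [← mul_assoc, h1, mul_assoc, ← hzcomm, ← mul_assoc, mul_assoc g, h1]
    rw [← mul_assoc, mul_assoc _ z z, hzz, mul_one, mul_assoc]

theorem IsExtraspecialTwo.not_comm (h : IsExtraspecialTwo G) : ¬ ∀ a b : G, a * b = b * a := by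
  intro h'
  have h1 : commutator G = ⊥ := by
    rw [eq_bot_iff]
    refine commutator_le_of_forall _ fun a b => ?_
    rw [Subgroup.mem_bot, h' a b]; group
  obtain ⟨z, hz, -, hzc, -⟩ := h.exists_central_involution
  refine hz ?_
  rw [← Subgroup.mem_bot, ← h1, ← h.center_eq_commutator]
  exact (hzc z).2 (Or.inr rfl)

end Extraspecial

/-! ### Forms and direct factors from central involutions -/

section Involutions

variable {G : Type*} [Group G]

/-- The homomorphism `ZMod 2 → G` sending `1` to a given involution. -/
def involutionMap (z : G) (a : ZMod 2) : G := if a = 0 then 1 else z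

theorem involutionMap_add {z : G} (hzz : z * z = 1) (a b : ZMod 2) :
    involutionMap z (a + b) = involutionMap z a * involutionMap z b := by
  have h10 : (1 : ZMod 2) ≠ 0 := by decide
  rcases ZMod.two_eq_zero_or_one a with rfl | rfl <;>
    rcases ZMod.two_eq_zero_or_one b with rfl | rfl <;>
    simp [involutionMap, ZMod.two_one_add_one, hzz]

theorem involutionMap_injective {z : G} (hz : z ≠ 1) :
    Function.Injective (involutionMap z) := by
  intro a b h
  rcases ZMod.two_eq_zero_or_one a with rfl | rfl <;>
    rcases ZMod.two_eq_zero_or_one b with rfl | rfl <;>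
    simp_all [involutionMap]

theorem involutionMap_comm {z : G} (hz : ∀ g, g * z = z * g) (a : ZMod 2) (g : G) :
    g * involutionMap z a = involutionMap z a * g := by
  unfold involutionMap
  split_ifs <;> simp [hz]

theorem exists_involutionMap_iff {z g : G} : (∃ a, involutionMap z a = g) ↔ g = 1 ∨ g = z := by
  constructor
  · rintro ⟨a, rfl⟩
    unfold involutionMap
    split_ifs <;> simp
  · rintro (rfl | rfl)
    · exact ⟨0, by simp [involutionMap]⟩
    · exact ⟨1, by simp [involutionMap]⟩

theorem exists_centralForm_two {z : G} (hz : z ≠ 1) (hzz : z * z = 1)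
    (hzc : ∀ g, g * z = z * g) (hsq : ∀ g : G, g * g = 1 ∨ g * g = z)
    (hcomm : ∀ g h : G, g * h = h * g ∨ g * h = h * g * z) :
    ∃ Φ : CentralForm G (ZMod 2), ∀ g, g ∈ Set.range Φ.ι ↔ g = 1 ∨ g = z := by
  have h1 : ∀ g : G, ∃ a, g * g = involutionMap z a := fun g => by
    obtain ⟨a, ha⟩ := exists_involutionMap_iff.2 (hsq g)
    exact ⟨a, ha.symm⟩
  have h2 : ∀ g h : G, ∃ a, g * h = h * g * involutionMap z a := fun g h => by
    rcases hcomm g h with h1 | h1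
    · exact ⟨0, by simp [involutionMap, h1]⟩
    · exact ⟨1, by simp [involutionMap, h1]⟩
  choose q hq using h1
  choose B hB using h2
  exact ⟨⟨involutionMap z, involutionMap_add hzz, involutionMap_injective hz,
    involutionMap_comm hzc, fun a => by revert a; decide, q, B, hq, hB⟩,
    fun g => exists_involutionMap_iff⟩

/-- A filled extraspecial 2-group does not contain a four-group meeting its centre trivially. -/
theorem IsExtraspecialTwo.not_isFilled (h : IsExtraspecialTwo G) {s y : G}
    (hs : s ∉ Subgroup.center G) (hy : y ∉ Subgroup.center G) (hsy : s * y ∉ Subgroup.center G)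
    (hss : s * s = 1) (hyy : y * y = 1) (hcomm : s * y = y * s) : ¬ IsFilled G := by
  have := h.finite
  obtain ⟨z, hz, hzz, hzc, hc, hsq⟩ := h.exists_central_involution
  have hzcomm : ∀ g, g * z = z * g :=
    Subgroup.mem_center_iff.1 ((hzc z).2 (Or.inr rfl))
  obtain ⟨Φ, hΦ⟩ := exists_centralForm_two hz hzz hzcomm hsq hc
  have hΦ' : ∀ g, g ∈ Set.range Φ.ι ↔ g ∈ Subgroup.center G := fun g => by rw [hΦ, hzc]
  have hnd : Φ.Nondegenerate := fun g hg => by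
    rw [hΦ', Subgroup.mem_center_iff]
    exact fun k => (Φ.B_eq_zero_iff.1 (hg k)).symm
  rw [← hΦ'] at hs hy hsy
  refine hnd.not_isFilled hs hy hsy ?_ ?_ (Φ.B_eq_zero_iff.2 hcomm)
  · rwa [Φ.mul_self, Φ.ι_eq_one] at hss
  · rwa [Φ.mul_self, Φ.ι_eq_one] at hyy

/-- A subgroup of index 2 is a direct factor if a central involution lies outside it. -/
theorem nonempty_mulEquiv_prod_of_central_involution {K : Subgroup G} {w : G} (hw : w ∉ K)
    (hww : w * w = 1) (hwc : ∀ g, g * w = w * g) (hK : ∀ g, g ∉ K → w * g ∈ K) :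
    Nonempty (G ≃* K × Multiplicative (ZMod 2)) := by
  let f : K × Multiplicative (ZMod 2) →* G :=
    { toFun := fun p => p.1 * involutionMap w p.2.toAdd
      map_one' := by simp [involutionMap]
      map_mul' := fun p p' => by
        simp only [Prod.fst_mul, Prod.snd_mul, toAdd_mul, Subgroup.coe_mul,
          involutionMap_add hww]
        rw [mul_assoc, mul_assoc, ← mul_assoc (p'.1 : G), involutionMap_comm hwc _ (p'.1 : G),
          mul_assoc] }
  have hf : Function.Bijective f := by
    constructor
    · rw [injective_iff_map_eq_one]
      rintro ⟨k, j⟩ h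
      have h : (k : G) * involutionMap w j.toAdd = 1 := h
      rcases ZMod.two_eq_zero_or_one j.toAdd with hj | hj
      · rw [hj] at h
        simp only [involutionMap, if_true, mul_one, OneMemClass.coe_eq_one] at h
        rw [h, ← ofAdd_toAdd j, hj]
        rfl
      · rw [hj] at h
        simp only [involutionMap, one_ne_zero, if_false] at h
        rw [← inv_eq_iff_mul_eq_one] at h
        exact absurd (h ▸ K.inv_mem k.2) hw
    · intro g
      by_cases hg : g ∈ K
      · exact ⟨(⟨g, hg⟩, 1), by simp [f, involutionMap]⟩
      · refine ⟨(⟨w * g, hK g hg⟩, Multiplicative.ofAdd 1), ?_⟩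
        simp only [f, involutionMap, MonoidHom.coe_mk, OneHom.coe_mk, toAdd_ofAdd, one_ne_zero,
          if_false]
        rw [mul_assoc, hwc, ← mul_assoc, hww, one_mul]
  exact ⟨(MulEquiv.ofBijective f hf).symm⟩

end Involutions

/-! ### Quotients by a central involution -/

section Quotient

variable {G E : Type*} [Group G] [Group E] {z : G} {π : G →* E}

theorem map_eq_map_iff (hker : ∀ g, π g = 1 ↔ g = 1 ∨ g = z) {g h : G} :
    π g = π h ↔ g = h ∨ g = h * z := by
  have : π g = π h ↔ π (h⁻¹ * g) = 1 := by rw [map_mul, map_inv, inv_mul_eq_one, eq_comm]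
  rw [this, hker, inv_mul_eq_one, inv_mul_eq_iff_eq_mul, eq_comm]

theorem map_mul_comm_iff (hker : ∀ g, π g = 1 ↔ g = 1 ∨ g = z) {g h : G} :
    π g * π h = π h * π g ↔ g * h = h * g ∨ g * h = h * g * z := by
  rw [← map_mul, ← map_mul, map_eq_map_iff hker]

theorem map_mem_center_iff (hπ : Function.Surjective π)
    (hker : ∀ g, π g = 1 ↔ g = 1 ∨ g = z) {g : G} :
    π g ∈ Subgroup.center E ↔ ∀ h, g * h = h * g ∨ g * h = h * g * z := by
  rw [Subgroup.mem_center_iff]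
  constructor
  · exact fun H h => (map_mul_comm_iff hker).1 (H (π h)).symm
  · intro H y
    obtain ⟨h, rfl⟩ := hπ y
    exact ((map_mul_comm_iff hker).2 (H h)).symm

/-- The quotient of a filled 2-group by a central involution. -/
theorem exists_central_quotient {G : Type u} [Group G] {n : ℕ} (hcard : Nat.card G = 2 ^ n)
    (hn : n ≠ 0) (hG : IsFilled G) {z : G} (hz : z ≠ 1) (hzz : z * z = 1)
    (hzc : ∀ g, g * z = z * g) :
    ∃ (E : Type u) (_ : Group E) (π : G →* E), Function.Surjective π ∧
      (∀ g, π g = 1 ↔ g = 1 ∨ g = z) ∧ Nat.card E = 2 ^ (n - 1) ∧ IsFilled E := by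
  have hN : (Subgroup.zpowers z).Normal :=
    ⟨fun k hk g => by
      obtain ⟨i, rfl⟩ := Subgroup.mem_zpowers_iff.1 hk
      have : Commute g (z ^ i) := (show Commute g z from hzc g).zpow_right i
      rw [this.eq, mul_inv_cancel_right]
      exact hk⟩
  have ho : orderOf z = 2 := orderOf_eq_prime (by rw [pow_two, hzz]) hz
  have hmem : ∀ g, g ∈ Subgroup.zpowers z ↔ g = 1 ∨ g = z := fun g => by
    constructor
    · intro hg
      obtain ⟨i, rfl⟩ := Subgroup.mem_zpowers_iff.1 hg
      rcases Int.even_or_odd' i with ⟨k, rfl | rfl⟩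
      · left
        rw [zpow_mul, zpow_two, hzz, one_zpow]
      · right
        rw [zpow_add, zpow_mul, zpow_two, hzz, one_zpow, one_mul, zpow_one]
    · rintro (rfl | rfl)
      · exact Subgroup.one_mem _
      · exact Subgroup.mem_zpowers _
  refine ⟨G ⧸ Subgroup.zpowers z, inferInstance, QuotientGroup.mk' _,
    QuotientGroup.mk'_surjective _, fun g => ?_, ?_,
    hG.of_surjective (QuotientGroup.mk'_surjective _)⟩
  · rw [← hmem, QuotientGroup.mk'_apply, QuotientGroup.eq_one_iff]
  · have h1 := Subgroup.card_eq_card_quotient_mul_card_subgroup (Subgroup.zpowers z)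
    rw [Nat.card_zpowers, ho, hcard] at h1
    obtain ⟨m, rfl⟩ := Nat.exists_eq_succ_of_ne_zero hn
    rw [Nat.succ_eq_add_one, pow_succ] at h1
    simpa using (Nat.eq_of_mul_eq_mul_right two_pos h1).symm

end Quotient

/-! ### Class 2 with a four-group as centre -/

namespace CentralForm

variable {G : Type u} [Group G]

set_option synthInstance.maxHeartbeats 200000 in
set_option synthInstance.maxSize 2000 in
/-- A group of class 2 whose centre is a four-group, and all of whose quotients by central
involutions are extraspecial and filled, is not filled. -/
theorem not_isFilled_of_extraspecial_quotients [Finite G] (Φ : CentralForm G (ZMod 2 × ZMod 2))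
    (hne : ∃ x, x ∉ Set.range Φ.ι)
    (hquot : ∀ c, c ≠ 0 → ∃ (E : Type u) (_ : Group E) (π : G →* E), Function.Surjective π ∧
      (∀ g, π g = 1 ↔ g = 1 ∨ g = Φ.ι c) ∧ IsExtraspecialTwo E ∧ IsFilled E) : ¬ IsFilled G := by
  have hB : ∀ c g h, (g * h = h * g ∨ g * h = h * g * Φ.ι c) ↔ (Φ.B g h = 0 ∨ Φ.B g h = c) := by
    intro c g h
    rw [Φ.B_eq_zero_iff, Φ.mul_comm g h]
    refine or_congr_right ?_
    rw [mul_right_inj, Φ.ι_injective.eq_iff]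
  -- Such a `g` is central modulo `ι c`. The centre of that quotient has order 2 and is generated by
  -- the image of `ι d`.
  have hcen : ∀ c, c ≠ 0 → ∀ g, (∀ h, Φ.B g h = 0 ∨ Φ.B g h = c) → g ∈ Set.range Φ.ι := by
    intro c hc g hg
    obtain ⟨E, _, π, hπ, hker, hE, -⟩ := hquot c hc
    obtain ⟨d, hd, hdc⟩ : ∃ d, d ≠ 0 ∧ d ≠ c :=
      (by decide : ∀ c : ZMod 2 × ZMod 2, ∃ d, d ≠ 0 ∧ d ≠ c) c
    obtain ⟨y, hy, -, hyc, -⟩ := hE.exists_central_involution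
    have h1 := (map_mem_center_iff hπ hker (g := g)).2 fun h => (hB c g h).2 (hg h)
    have h2 := (map_mem_center_iff hπ hker (g := Φ.ι d)).2 fun h =>
      Or.inl (Φ.ι_comm d h).symm
    have h3 : π (Φ.ι d) ≠ 1 := by
      rw [Ne, hker, Φ.ι_eq_one, Φ.ι_injective.eq_iff]
      tauto
    rw [hyc] at h1 h2
    rcases h1 with h1 | h1
    · rcases (hker g).1 h1 with rfl | rfl
      · exact ⟨0, Φ.ι_zero⟩
      · exact ⟨c, rfl⟩
    · rw [← h2.resolve_left h3, map_eq_map_iff hker] at h1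
      rcases h1 with rfl | rfl
      · exact ⟨d, rfl⟩
      · exact ⟨d + c, Φ.ι_add _ _⟩
  -- By `hcen`, the image of `B g` lies in no line `{0, c}`, and two distinct nonzero values
  -- generate `F₂²`.
  have hsurj : ∀ g, g ∉ Set.range Φ.ι → ∀ c, ∃ h, Φ.B g h = c := by
    intro g hg c
    have hex : ∀ d, d ≠ 0 → ∃ h, Φ.B g h ≠ 0 ∧ Φ.B g h ≠ d := by
      intro d hd
      by_contra! h
      exact hg (hcen d hd g fun k => or_iff_not_imp_left.2 (h k))
    obtain ⟨h₁, h10, -⟩ := hex (1, 0) (by decide)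
    obtain ⟨h₂, h20, h21⟩ := hex _ h10
    have key : ∀ c v w : ZMod 2 × ZMod 2, v ≠ 0 → w ≠ 0 → w ≠ v →
      c = 0 ∨ c = v ∨ c = w ∨ c = v + w := by decide
    rcases key c _ _ h10 h20 h21 with h | h | h | h
    · exact ⟨1, by rw [h, Φ.B_one_right]⟩
    · exact ⟨h₁, h.symm⟩
    · exact ⟨h₂, h.symm⟩
    · exact ⟨h₁ * h₂, by rw [h, Φ.B_mul_right]⟩
  obtain ⟨x, hx⟩ := hne
  by_cases hq : ∀ g, Φ.q g = 0 → g ∈ Set.range Φ.ι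
  · exact Φ.not_isFilled_of_anisotropic hq hsurj hx
  push Not at hq
  obtain ⟨s, hqs, hs⟩ := hq
  obtain ⟨y, hsy, hy, hsy'⟩ : ∃ y, Φ.B s y = 0 ∧ y ∉ Set.range Φ.ι ∧ s * y ∉ Set.range Φ.ι := by
    obtain ⟨a, ha⟩ : ∃ a : ZMod 2 × ZMod 2, a = (1, 0) := ⟨_, rfl⟩
    obtain ⟨b, hb⟩ : ∃ b : ZMod 2 × ZMod 2, b = (0, 1) := ⟨_, rfl⟩
    obtain ⟨y₁, h₁⟩ := hsurj s hs a
    obtain ⟨y₂, h₂⟩ := hsurj s hs b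
    -- Replacing `y₁` by `s * y₁` adds `b` to the pairing with `y₂`, so it can be moved into `{0,
    -- a}`. Then `r` and `y₂` can correct `B s g` to zero without moving `B r g` into `{0, a}`.
    obtain ⟨r, hsr, hr⟩ : ∃ r, Φ.B s r = a ∧ (Φ.B r y₂ = 0 ∨ Φ.B r y₂ = a) := by
      have key : ∀ v : ZMod 2 × ZMod 2,
        (v = 0 ∨ v = (1, 0)) ∨ ((0, 1) + v = 0 ∨ (0, 1) + v = (1, 0)) := by decide
      rcases key (Φ.B y₁ y₂) with h | h
      · exact ⟨y₁, h₁, by rwa [ha]⟩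
      · exact ⟨s * y₁, by rw [Φ.B_mul_right, Φ.B_self, zero_add, h₁],
          by rwa [Φ.B_mul_left, h₂, ha, hb]⟩
    obtain ⟨g, hg⟩ : ∃ g, ¬ (Φ.B r g = 0 ∨ Φ.B r g = a) := by
      by_contra! h
      have hr' : r ∉ Set.range Φ.ι := by
        rintro ⟨c, rfl⟩
        rw [Φ.B_ι_right, ha] at hsr
        exact absurd hsr (by decide)
      exact hr' (hcen a (by rw [ha]; decide) r h)
    obtain ⟨y, hy, hry⟩ : ∃ y, Φ.B s y = 0 ∧ ¬ (Φ.B r y = 0 ∨ Φ.B r y = a) := by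
      have key₁ : ∀ v : ZMod 2 × ZMod 2, v = 0 ∨ v = (1, 0) ∨ v = (0, 1) ∨ v = (1, 0) + (0, 1) := by
        decide
      have key₂ : ∀ v w : ZMod 2 × ZMod 2, ¬ (v = 0 ∨ v = (1, 0)) → (w = 0 ∨ w = (1, 0)) →
        ¬ (v + w = 0 ∨ v + w = (1, 0)) := by decide
      rw [← ha, ← hb] at key₁
      rw [← ha] at key₂
      rcases key₁ (Φ.B s g) with h | h | h | h
      · exact ⟨g, h, hg⟩
      · exact ⟨g * r, by rw [Φ.B_mul_right, h, hsr, Φ.add_self],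
          by rwa [Φ.B_mul_right, Φ.B_self, add_zero]⟩
      · exact ⟨g * y₂, by rw [Φ.B_mul_right, h, h₂, Φ.add_self],
          by rw [Φ.B_mul_right]; exact key₂ _ _ hg hr⟩
      · refine ⟨g * (r * y₂), ?_, ?_⟩
        · rw [Φ.B_mul_right, Φ.B_mul_right, h, hsr, h₂, Φ.add_self]
        · rw [Φ.B_mul_right, Φ.B_mul_right, Φ.B_self, zero_add]
          exact key₂ _ _ hg hr
    refine ⟨y, hy, ?_, ?_⟩
    · rintro ⟨c, rfl⟩
      exact hry (Or.inl (Φ.B_ι_right _ _))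
    · rintro ⟨c, hc⟩
      have h1 : Φ.B r (s * y) = 0 := by rw [← hc, Φ.B_ι_right]
      rw [Φ.B_mul_right, Φ.B_comm, hsr] at h1
      exact hry (Or.inr (Φ.eq_of_add_eq_zero h1).symm)
  -- `c` is chosen to make `y² = 1` modulo `ι c`; `s` is already an involution.
  obtain ⟨c, hc, hqy⟩ : ∃ c, c ≠ 0 ∧ (Φ.q y = 0 ∨ Φ.q y = c) := by
    by_cases h : Φ.q y = 0
    · exact ⟨(1, 0), by decide, Or.inl h⟩
    · exact ⟨_, h, Or.inr rfl⟩
  obtain ⟨E, _, π, hπ, hker, hE, hfill⟩ := hquot c hc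
  have hnc : ∀ g, g ∉ Set.range Φ.ι → π g ∉ Subgroup.center E := by
    intro g hg h
    rw [map_mem_center_iff hπ hker] at h
    exact hg (hcen c hc g fun k => (hB c g k).1 (h k))
  refine absurd hfill (hE.not_isFilled (hnc s hs) (hnc y hy) ?_ ?_ ?_ ?_)
  · rw [← map_mul]
    exact hnc _ hsy'
  · rw [← map_mul, Φ.mul_self, hqs, Φ.ι_zero, map_one]
  · rw [← map_mul, Φ.mul_self, hker]
    rcases hqy with h | h
    · rw [h, Φ.ι_zero]; exact Or.inl rfl
    · rw [h]; exact Or.inr rfl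
  · rw [← map_mul, ← map_mul, Φ.B_eq_zero_iff.1 hsy]

end CentralForm

/-! ### Class 3 -/

/-- A 2-group of class 3 whose central quotient by `⟨z⟩` is extraspecial has maximal class and
order 16, hence is not filled. -/
theorem not_isFilled_of_class_three {G : Type*} [Group G] [Finite G] {z u : G} (hz : z ≠ 1)
    (hzz : z * z = 1) (hzc : ∀ g, g * z = z * g)
    (hcen : ∀ g, (∀ h, g * h = h * g ∨ g * h = h * g * z) →
      g = 1 ∨ g = z ∨ g = u ∨ g = u * z)
    (hu : ∀ h, u * h = h * u ∨ u * h = h * u * z) (hunc : ¬ ∀ h, u * h = h * u)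
    (hcomm : ∀ g h, ∃ p, (p = 1 ∨ p = z ∨ p = u ∨ p = u * z) ∧ g * h = h * g * p)
    (hsq : ∀ g, g * g = 1 ∨ g * g = z ∨ g * g = u ∨ g * g = u * z) : ¬ IsFilled G := by
  push Not at hunc
  obtain ⟨t, hut⟩ := hunc
  have hut' : u * t = t * u * z := (hu t).resolve_left hut
  have hzr : ∀ g h, g * z * h = g * h * z := fun g h => by rw [mul_assoc, ← hzc, mul_assoc]
  have hzz' : ∀ g, g * z * z = g := fun g => by rw [mul_assoc, hzz, mul_one]
  -- the element `r`
  obtain ⟨r, hur, htr⟩ : ∃ r, u * r = r * u ∧ ¬ (t * r = r * t ∨ t * r = r * t * z) := by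
    obtain ⟨g, hg⟩ : ∃ g, ¬ (t * g = g * t ∨ t * g = g * t * z) := by
      by_contra! h
      rcases hcen t h with rfl | rfl | rfl | rfl
      · exact hut (by simp)
      · exact hut (hzc u)
      · exact hut rfl
      · exact hut (by rw [hzr, mul_assoc])
    rcases hu g with h | h
    · exact ⟨g, h, hg⟩
    · refine ⟨g * t, ?_, ?_⟩
      · rw [← mul_assoc, h, hzr, mul_assoc g u t, hut', ← mul_assoc, hzz', mul_assoc]
      · rintro (h1 | h1)
        · exact hg (Or.inl (mul_right_cancel (by rwa [← mul_assoc] at h1)))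
        · refine hg (Or.inr (mul_right_cancel (b := t) ?_))
          rwa [← mul_assoc, ← hzr] at h1
  obtain ⟨v, hv, hvr⟩ := hcomm t r
  have hv' : v = u ∨ v = u * z := by
    rcases hv with h | h | h
    · exact absurd (Or.inl (by rw [hvr, h, mul_one])) htr
    · exact absurd (Or.inr (by rw [hvr, h])) htr
    · exact h
  -- from now on `v` plays the role of `u`
  have hP : ∀ g, (g = 1 ∨ g = z ∨ g = u ∨ g = u * z) → (g = 1 ∨ g = z ∨ g = v ∨ g = v * z) := by
    intro g hg
    rcases hv' with rfl | rfl
    · exact hg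
    · rw [hzz']; tauto
  have hcen' := fun g hg => hP g (hcen g hg)
  have hsq' := fun g => hP _ (hsq g)
  have hcomm' : ∀ g h, ∃ p, (p = 1 ∨ p = z ∨ p = v ∨ p = v * z) ∧ g * h = h * g * p := fun g h => by
    obtain ⟨p, hp, h'⟩ := hcomm g h
    exact ⟨p, hP p hp, h'⟩
  have hvh : ∀ h, v * h = h * v ∨ v * h = h * v * z := by
    rcases hv' with rfl | rfl
    · exact hu
    · intro h
      rw [hzr, ← mul_assoc]
      rcases hu h with h1 | h1
      · left; rw [h1]
      · right; rw [h1]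
  have hvr' : v * r = r * v := by
    rcases hv' with rfl | rfl
    · exact hur
    · rw [hzr, ← mul_assoc, hur]
  have hvt : v * t = t * v * z := by
    rcases hv' with rfl | rfl
    · exact hut'
    · rw [hzr, hut', ← mul_assoc]
  have hPv : ∀ p, (p = 1 ∨ p = z ∨ p = v ∨ p = v * z) → ∀ a, v * a = a * v → a * p = p * a := by
    rintro p (rfl | rfl | rfl | rfl) a ha
    · simp
    · exact hzc a
    · exact ha.symm
    · rw [hzr, ha, ← mul_assoc]
  have hPt : ∀ p, (p = 1 ∨ p = z ∨ p = v ∨ p = v * z) → p * t = t * p → p = 1 ∨ p = z := by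
    rintro p (rfl | rfl | rfl | rfl) h
    · exact Or.inl rfl
    · exact Or.inr rfl
    · rw [hvt, mul_eq_left] at h
      exact absurd h hz
    · rw [hzr, ← mul_assoc, hvt, mul_eq_left] at h
      exact absurd h hz
  have htt : t * t = 1 ∨ t * t = z := hPt _ (hsq' t) (mul_assoc _ _ _)
  have hvt' : t * v = v * t * z := by rw [hvt, hzz']
  -- `v` has order 4
  have hvv : v * v = z := by
    -- Conjugating by `t` twice multiplies `r` by `v²z`, whereas `t²` is central.
    have h1 : t * t * r = r * (t * t) * (v * v) * z := by
      calc t * t * r = t * (r * t * v) := by rw [mul_assoc, hvr]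
        _ = t * r * t * v := by group
        _ = r * t * (v * t) * v := by rw [hvr]; group
        _ = r * t * (t * v * z) * v := by rw [hvt]
        _ = r * (t * t) * v * z * v := by group
        _ = r * (t * t) * (v * v) * z := by rw [hzr]; group
    have h2 : t * t * r = r * (t * t) := by
      rcases htt with h | h
      · rw [h]; simp
      · rw [h, hzc]
    rw [h2, mul_assoc, left_eq_mul] at h1
    calc v * v = v * v * z * z := (hzz' _).symm
      _ = z := by rw [h1, one_mul]
  -- `r` has order 8
  have hrr : r * r = v ∨ r * r = v * z := by
    have h1 : t * (r * r) = r * r * t * z := by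
      calc t * (r * r) = r * t * (v * r) := by rw [← mul_assoc, hvr]; group
        _ = r * (t * r) * v := by rw [hvr']; group
        _ = r * r * t * (v * v) := by rw [hvr]; group
        _ = _ := by rw [hvv]
    have h2 : ¬ (r * r * t = t * (r * r)) := fun h => by
      rw [h1, left_eq_mul] at h
      exact hz h
    rcases hsq' r with h | h | h
    · exact absurd (by rw [h]; simp) h2
    · exact absurd (by rw [h, hzc]) h2
    · exact h
  have hr4 : r ^ 4 = z := by
    have h1 : r ^ 4 = r * r * (r * r) := by simp only [pow_succ, pow_zero, one_mul, mul_assoc]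
    rw [h1]
    rcases hrr with h | h
    · rw [h, hvv]
    · rw [h, ← mul_assoc, hzr, hzz', hvv]
  have hr8 : r ^ 8 = 1 := by rw [show 8 = 4 + 4 from rfl, pow_add, hr4, hzz]
  have hvpow : ∃ k : ℕ, v = r ^ k := by
    rcases hrr with h | h
    · exact ⟨2, by rw [pow_two, h]⟩
    · exact ⟨6, by rw [show 6 = 2 + 4 from rfl, pow_add, hr4, pow_two, h, hzz']⟩
  have hPpow : ∀ p, (p = 1 ∨ p = z ∨ p = v ∨ p = v * z) → ∃ k : ℕ, p = r ^ k := by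
    obtain ⟨k, hk⟩ := hvpow
    rintro p (rfl | rfl | rfl | rfl)
    · exact ⟨0, by simp⟩
    · exact ⟨4, hr4.symm⟩
    · exact ⟨k, hk⟩
    · exact ⟨k + 4, by rw [pow_add, hr4, ← hk]⟩
  -- commutators of the centralizer of `v`
  have hC : ∀ a b, v * a = a * v → v * b = b * v → a * b = b * a ∨ a * b = b * a * z := by
    intro a b ha hb
    obtain ⟨p, hp, hab⟩ := hcomm' a b
    obtain ⟨pa, hpa, hta⟩ := hcomm' t a
    obtain ⟨pb, hpb, htb⟩ := hcomm' t b
    have hPP : ∀ p, (p = 1 ∨ p = z ∨ p = v ∨ p = v * z) → v * p = p * v := fun p hp =>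
      hPv p hp v rfl
    -- Conjugation by `t` multiplies `ab` and `ba` by the same element, so it fixes `p`; then `hPt`
    -- applies.
    have h1 : t * (a * b) = a * b * t * (pb * pa) := by
      calc t * (a * b) = a * t * (pa * b) := by rw [← mul_assoc, hta]; group
        _ = a * (t * b) * pa := by rw [← hPv pa hpa b hb]; group
        _ = _ := by rw [htb]; group
    have h2 : t * (b * a) = b * a * t * (pb * pa) := by
      calc t * (b * a) = b * t * (pb * a) := by rw [← mul_assoc, htb]; group
        _ = b * (t * a) * pb := by rw [← hPv pb hpb a ha]; group
        _ = b * a * t * (pa * pb) := by rw [hta]; group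
        _ = _ := by rw [hPv pb hpb pa (hPP pa hpa)]
    have h3 : b * a * (p * t) * (pb * pa) = b * a * (t * p) * (pb * pa) := by
      calc b * a * (p * t) * (pb * pa) = a * b * t * (pb * pa) := by rw [hab]; group
        _ = t * (b * a) * p := by rw [← h1, hab]; group
        _ = b * a * t * (pb * (pa * p)) := by rw [h2]; group
        _ = b * a * t * (pb * (p * pa)) := by rw [hPv p hp pa (hPP pa hpa)]
        _ = b * a * t * ((p * pb) * pa) := by rw [← hPv p hp pb (hPP pb hpb)]; group
        _ = _ := by group
    rcases hPt p hp (mul_left_cancel (mul_right_cancel h3)) with rfl | rfl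
    · left; rw [hab, mul_one]
    · right; exact hab
  have hCt : ∀ h, v * h = h * v ∨ v * (h * t) = h * t * v := by
    intro h
    rcases hvh h with h1 | h1
    · exact Or.inl h1
    · right
      rw [← mul_assoc, h1, hzr, mul_assoc h v t, hvt, ← mul_assoc, hzz', mul_assoc]
  -- an element of the centralizer of `v` commuting with `t` modulo `⟨z⟩` lies in `⟨v, z⟩`
  have hCP : ∀ a, v * a = a * v → (a * t = t * a ∨ a * t = t * a * z) → ∃ k : ℕ, a = r ^ k := by
    intro a ha hat
    refine hPpow a (hcen' a fun h => ?_)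
    rcases hCt h with h1 | h1
    · exact hC a h ha h1
    · have h2 := hC a (h * t) ha h1
      have h3 : a * (h * t) = a * h * t := (mul_assoc _ _ _).symm
      have h4 : h * t * a = h * a * t ∨ h * t * a = h * a * t * z := by
        rcases hat with h5 | h5
        · left; rw [mul_assoc, ← h5, ← mul_assoc]
        · right; rw [mul_assoc h a t, h5, ← mul_assoc, hzz', mul_assoc]
      rw [h3] at h2
      rcases h2 with h2 | h2 <;> rcases h4 with h4 | h4 <;> rw [h4] at h2
      · left; exact mul_right_cancel h2
      · right; exact mul_right_cancel (b := t) (by rw [h2, hzr])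
      · right; exact mul_right_cancel (b := t) (by rw [h2, hzr])
      · left; exact mul_right_cancel (b := t) (by rw [h2, hzz'])
  -- Since `t * r = r * t * v`, either `a` or `ar` commutes with `t` modulo `⟨z⟩`, and `hCP` applies
  -- to it.
  have hCr : ∀ a, v * a = a * v → ∃ k : ℕ, a = r ^ k := by
    intro a ha
    obtain ⟨p, hp, hta⟩ := hcomm' t a
    have h1 : ∀ b, (t * b = b * t ∨ t * b = b * t * z) → (b * t = t * b ∨ b * t = t * b * z) := by
      rintro b (h | h)
      · left; exact h.symm
      · right; rw [h, hzz']
    have h2 : t * (a * r) = a * r * t * (v * p) := by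
      calc t * (a * r) = a * t * (p * r) := by rw [← mul_assoc, hta]; group
        _ = a * (t * r) * p := by rw [← hPv p hp r hvr']; group
        _ = _ := by rw [hvr]; group
    have h3 : v * (a * r) = a * r * v := by rw [← mul_assoc, ha, mul_assoc, hvr', mul_assoc]
    have h4 : (v * p = 1 ∨ v * p = z) → ∃ k : ℕ, a = r ^ k := by
      intro h
      obtain ⟨k, hk⟩ := hCP (a * r) h3 (h1 _ (by
        rcases h with h | h
        · left; rw [h2, h, mul_one]
        · right; rw [h2, h]))
      refine ⟨k + 7, ?_⟩
      rw [pow_add, ← hk, mul_assoc, ← pow_succ', hr8, mul_one]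
    rcases hp with rfl | rfl | rfl | rfl
    · exact hCP a ha (h1 a (Or.inl (by rw [hta, mul_one])))
    · exact hCP a ha (h1 a (Or.inr hta))
    · exact h4 (Or.inr hvv)
    · exact h4 (Or.inl (by rw [← mul_assoc, hvv, hzz]))
  have hvrk : ∀ k : ℕ, v * r ^ k = r ^ k * v := fun k =>
    ((show Commute v r from hvr').pow_right k).eq
  obtain ⟨e, he, hrt⟩ : ∃ e : ZMod 8, (e = 3 ∨ e = 7) ∧ t * r = r ^ e.val * t := by
    have h1 : t * r = r * v * t * z := by rw [hvr, mul_assoc, hvt']; group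
    -- With `z = r⁴`, the exponent in `t * r = r * v * z * t` is 7 if `v = r²` and 3 if `v = r²z`.
    rcases hrr with h | h
    · refine ⟨7, Or.inr rfl, ?_⟩
      rw [h1, ← h, hzr _ t |>.symm, ← hr4, show (7 : ZMod 8).val = 7 from rfl]
      group
    · refine ⟨3, Or.inl rfl, ?_⟩
      have h2 : v = r * r * z := by rw [h, hzz']
      rw [h1, h2, ← mul_assoc, hzr, hzz', show (3 : ZMod 8).val = 3 from rfl]
      simp only [pow_succ, pow_zero, one_mul, mul_assoc]
  obtain ⟨c, hc, htc⟩ : ∃ c : ZMod 8, (c = 0 ∨ c = 4) ∧ t * t = r ^ c.val := by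
    rcases htt with h | h
    · exact ⟨0, Or.inl rfl, by rw [h, ZMod.val_zero, pow_zero]⟩
    · exact ⟨4, Or.inr rfl, by rw [h, show (4 : ZMod 8).val = 4 from rfl, hr4]⟩
  refine not_isFilled_of_maximal_class he hc (by rwa [hr4]) hr8 hrt htc ?_ ?_
  · rintro k rfl
    rw [hvrk, left_eq_mul] at hvt
    exact hz hvt
  · intro g
    rcases hCt g with h | h
    · obtain ⟨k, hk⟩ := hCr g h
      exact ⟨k, Or.inl hk⟩
    · obtain ⟨k, hk⟩ := hCr _ h
      rcases htt with h1 | h1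
      · exact ⟨k, Or.inr (by rw [← hk, mul_assoc, h1, mul_one])⟩
      · exact ⟨k + 4, Or.inr (by rw [pow_add, hr4, ← hk, hzr, mul_assoc g, h1, hzz'])⟩

/-! ### Assembling the cases -/

variable {G : Type u} [Group G]

theorem IsPGroup.exists_central_involution [Finite G] [Nontrivial G] (hG : IsPGroup 2 G) :
    ∃ z : G, z ≠ 1 ∧ z * z = 1 ∧ ∀ g, g * z = z * g := by
  have : Fact (Nat.Prime 2) := ⟨Nat.prime_two⟩
  have hc := hG.center_nontrivial
  obtain ⟨k, hk, hk'⟩ := (hG.to_subgroup (Subgroup.center G)).nontrivial_iff_card.1 hc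
  obtain ⟨z, hz⟩ := exists_prime_orderOf_dvd_card' (G := Subgroup.center G) 2
    (hk' ▸ dvd_pow_self 2 hk.ne')
  refine ⟨z, ?_, ?_, fun g => Subgroup.mem_center_iff.1 z.2 g⟩
  · rintro h
    have h1 : z = 1 := by ext; exact h
    rw [h1, orderOf_one] at hz
    exact absurd hz (by decide)
  · have h1 := pow_orderOf_eq_one z
    rw [hz, pow_two] at h1
    exact congrArg Subtype.val h1

/-- The case of a filled group with a central involution whose quotient is elementary abelian. -/
theorem IsFilled.of_elementaryAbelian_quotient {n : ℕ} (hcard : Nat.card G = 2 ^ n) (hn : n ≠ 0)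
    (hG : IsFilled G) (hind : ∀ (H : Type u) [Group H], Nat.card H = 2 ^ (n - 1) → IsFilled H →
      IsElementaryAbelianTwo H ∨ IsExtraspecialTwo H) {z : G} (hz : z ≠ 1) (hzz : z * z = 1)
    (hzc : ∀ g, g * z = z * g) (hsq : ∀ g : G, g * g = 1 ∨ g * g = z)
    (hcomm : ∀ g h : G, g * h = h * g ∨ g * h = h * g * z) :
    IsElementaryAbelianTwo G ∨ IsExtraspecialTwo G ∨
      ∃ (E : Type u) (_ : Group E), Nat.card E = 2 ^ (n - 1) ∧ IsFilled E ∧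
        IsExtraspecialTwo E ∧ Nonempty (G ≃* E × Multiplicative (ZMod 2)) := by
  have hfin : Finite G := Nat.finite_of_card_ne_zero (by rw [hcard]; positivity)
  have hpG : IsPGroup 2 G := IsPGroup.of_card hcard
  by_cases hex : ∃ g : G, g * g = z
  swap
  · left
    have h1 : ∀ g : G, g * g = 1 := fun g => (hsq g).resolve_right fun h => hex ⟨g, h⟩
    have hinv : ∀ g : G, g⁻¹ = g := fun g => inv_eq_of_mul_eq_one_left (h1 g)
    refine ⟨fun a b => ?_, fun g => by rw [pow_two, h1]⟩
    rw [← hinv (a * b), mul_inv_rev, hinv, hinv]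
  have hnosqrt : ∀ x : G, (∀ g, g * x = x * g) → x * x = 1 := fun x hx =>
    (hsq x).resolve_right fun h => not_isFilled_of_central_sqrt hz hsq hx h hG
  right
  by_cases hw : ∃ w : G, w ≠ 1 ∧ w ≠ z ∧ ∀ g, g * w = w * g
  swap
  · left
    refine isExtraspecialTwo_of_center hpG hz hzz (fun g => ?_) hsq hcomm hex
    rw [Subgroup.mem_center_iff]
    constructor
    · intro hg
      by_contra! h
      exact hw ⟨g, h.1, h.2, hg⟩
    · rintro (rfl | rfl)
      · simp
      · exact hzc
  right
  obtain ⟨w, hw1, hwz, hwc⟩ := hw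
  have hww := hnosqrt w hwc
  obtain ⟨E, _, π, hπ, hker, hcardE, hfillE⟩ := exists_central_quotient hcard hn hG hw1 hww hwc
  have hE : IsExtraspecialTwo E := by
    -- The nontrivial image of `z` is a square in `E`, which is therefore not elementary abelian.
    refine (hind E hcardE hfillE).resolve_left fun h => ?_
    obtain ⟨g, hg⟩ := hex
    have h1 := h.2 (π g)
    rw [pow_two, ← map_mul, hg, hker] at h1
    rcases h1 with h1 | h1
    · exact hz h1
    · exact hwz h1.symm
  -- a complement of `w`
  let P : Subgroup G :=
    { carrier := {g | g = 1 ∨ g = z}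
      one_mem' := Or.inl rfl
      mul_mem' := by
        rintro a b (rfl | rfl) (rfl | rfl) <;> simp [hzz]
      inv_mem' := by
        rintro a (rfl | rfl)
        · simp
        · right; exact inv_eq_of_mul_eq_one_left hzz }
  have hPmem : ∀ g, g ∈ P ↔ g = 1 ∨ g = z := fun g => Iff.rfl
  obtain ⟨K, hPK, hwK, hK⟩ := exists_hyperplane P (fun g => hsq g) (fun g h => by
    rcases hcomm g h with h1 | h1
    · left; rw [h1]; group
    · right; rw [h1, hzc]; group) (y := w) (by rw [hPmem]; tauto)
  have hzK : z ∈ K := hPK (Or.inr rfl)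
  obtain ⟨e⟩ := nonempty_mulEquiv_prod_of_central_involution hwK hww hwc hK
  have hfillK : IsFilled K := hG.of_surjective (f := (MonoidHom.fst K _).comp e.toMonoidHom)
    (fun k => ⟨e.symm (k, 1), by simp⟩)
  have hcardK : Nat.card K = 2 ^ (n - 1) := by
    have h1 := Nat.card_congr e.toEquiv
    rw [Nat.card_prod, hcard] at h1
    obtain ⟨m, rfl⟩ := Nat.exists_eq_succ_of_ne_zero hn
    rw [Nat.succ_eq_add_one, pow_succ] at h1
    have h2 : Nat.card (Multiplicative (ZMod 2)) = 2 := by simp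
    rw [h2] at h1
    simpa using (Nat.eq_of_mul_eq_mul_right two_pos h1).symm
  refine ⟨K, inferInstance, hcardK, hfillK, ?_, ⟨e⟩⟩
  refine isExtraspecialTwo_of_center (z := ⟨z, hzK⟩) (hpG.to_subgroup K) ?_ ?_ ?_ ?_ ?_ ?_
  · exact fun h => hz (congrArg Subtype.val h)
  · exact Subtype.ext hzz
  · rintro ⟨k, hk⟩
    rw [Subgroup.mem_center_iff, Subgroup.mk_eq_one, Subtype.mk_eq_mk]
    constructor
    · intro hkc
      -- `K` and the central `w` generate `G`, so `k` is central in `G`. Its image lies in `Z(E) =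
      -- {1, π z}`, and `w ∉ K` leaves only `k = 1` or `k = z`.
      have hkc' : ∀ g, g * k = k * g := by
        intro g
        by_cases hg : g ∈ K
        · exact congrArg Subtype.val (hkc ⟨g, hg⟩)
        · have h1 : w * g * k = k * (w * g) := congrArg Subtype.val (hkc ⟨_, hK g hg⟩)
          rw [← mul_assoc, hwc k, mul_assoc, mul_assoc] at h1
          exact mul_left_cancel h1
      obtain ⟨y, hy, -, hyc, -⟩ := hE.exists_central_involution
      have h1 : π k ∈ Subgroup.center E :=
        (map_mem_center_iff hπ hker).2 fun h => Or.inl (hkc' h).symm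
      have h2 : π z ∈ Subgroup.center E :=
        (map_mem_center_iff hπ hker).2 fun h => Or.inl (hzc h).symm
      have h3 : π z ≠ 1 := by
        rw [Ne, hker]
        rintro (h | h)
        · exact hz h
        · exact hwz h.symm
      rw [hyc] at h1 h2
      rcases h1 with h1 | h1
      · rcases (hker k).1 h1 with rfl | rfl
        · exact Or.inl rfl
        · exact absurd hk hwK
      · rw [← h2.resolve_left h3, map_eq_map_iff hker] at h1
        rcases h1 with rfl | rfl
        · exact Or.inr rfl
        · exact absurd ((K.mul_mem_cancel_left hzK).1 hk) hwK
    · rintro (rfl | rfl) ⟨g, hg⟩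
      · ext; simp
      · ext; exact hzc g
  · rintro ⟨k, hk⟩
    rcases hsq k with h | h
    · exact Or.inl (Subtype.ext h)
    · exact Or.inr (Subtype.ext h)
  · rintro ⟨k, hk⟩ ⟨l, hl⟩
    rcases hcomm k l with h | h
    · exact Or.inl (Subtype.ext h)
    · exact Or.inr (Subtype.ext h)
  · obtain ⟨g, hg⟩ := hex
    by_cases hgK : g ∈ K
    · exact ⟨⟨g, hgK⟩, Subtype.ext hg⟩
    · refine ⟨⟨w * g, hK g hgK⟩, Subtype.ext ?_⟩
      show w * g * (w * g) = z
      rw [mul_assoc, ← mul_assoc g w g, hwc g, mul_assoc w g g, ← mul_assoc w w, hww, one_mul, hg]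

/-- A nontrivial finite 2-group cannot be filled if its quotients by central involutions are all
filled and extraspecial. -/
theorem not_isFilled_of_forall_extraspecial_quotient [Finite G] [Nontrivial G]
    (hpG : IsPGroup 2 G)
    (hquot : ∀ z : G, z ≠ 1 → z * z = 1 → (∀ g, g * z = z * g) →
      ∃ (E : Type u) (_ : Group E) (π : G →* E), Function.Surjective π ∧
        (∀ g, π g = 1 ↔ g = 1 ∨ g = z) ∧ IsExtraspecialTwo E ∧ IsFilled E) : ¬ IsFilled G := by
  obtain ⟨z, hz, hzz, hzc⟩ := IsPGroup.exists_central_involution hpG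
  obtain ⟨E, _, π, hπ, hker, hE, -⟩ := hquot z hz hzz hzc
  obtain ⟨y, hy, -, hyc, hEcomm, hEsq⟩ := hE.exists_central_involution
  obtain ⟨u, rfl⟩ := hπ y
  have hmap : ∀ g, (π g = 1 ∨ π g = π u) ↔ g = 1 ∨ g = z ∨ g = u ∨ g = u * z := fun g => by
    rw [hker, map_eq_map_iff hker, or_assoc]
  have hu : ∀ h, u * h = h * u ∨ u * h = h * u * z :=
    (map_mem_center_iff hπ hker).1 ((hyc _).2 (Or.inr rfl))
  have hcen : ∀ g, (∀ h, g * h = h * g ∨ g * h = h * g * z) →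
      g = 1 ∨ g = z ∨ g = u ∨ g = u * z := fun g hg => by
    rw [← hmap, ← hyc]
    exact (map_mem_center_iff hπ hker).2 hg
  have hsq : ∀ g, g * g = 1 ∨ g * g = z ∨ g * g = u ∨ g * g = u * z := fun g => by
    rw [← hmap, map_mul]
    exact hEsq _
  have hcomm : ∀ g h, ∃ p, (p = 1 ∨ p = z ∨ p = u ∨ p = u * z) ∧ g * h = h * g * p := by
    intro g h
    refine ⟨(h * g)⁻¹ * (g * h), ?_, by rw [mul_inv_cancel_left]⟩
    rw [← hmap]
    simp only [map_mul, map_inv]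
    rcases hEcomm (π g) (π h) with h1 | h1
    · left; rw [h1, inv_mul_cancel]
    · right; rw [h1, inv_mul_cancel_left]
  by_cases huc : ∀ h, u * h = h * u
  swap
  · exact not_isFilled_of_class_three hz hzz hzc hcen hu huc hcomm hsq
  have huz : u ≠ 1 ∧ u ≠ z := by
    rw [Ne, hker] at hy
    tauto
  have hzr : ∀ g h, g * z * h = g * h * z := fun g h => by rw [mul_assoc, ← hzc, mul_assoc]
  have hzz' : ∀ g, g * z * z = g := fun g => by rw [mul_assoc, hzz, mul_one]
  have hPc : ∀ p, (p = 1 ∨ p = z ∨ p = u ∨ p = u * z) → ∀ h, h * p = p * h := by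
    rintro p (rfl | rfl | rfl | rfl) h
    · simp
    · exact hzc h
    · exact (huc h).symm
    · rw [hzr, huc h, ← mul_assoc]
  obtain ⟨a, b, hab⟩ : ∃ a b : G, ¬ (a * b = b * a ∨ a * b = b * a * z) := by
    by_contra! h
    refine hE.not_comm fun x y => ?_
    obtain ⟨a, rfl⟩ := hπ x
    obtain ⟨b, rfl⟩ := hπ y
    exact (map_mul_comm_iff hker).2 (h a b)
  have huu : u * u = 1 := by
    rcases hsq u with h | h | h | h
    · exact h
    -- If `u² = z`, every commutator `p` has `p² = 1` because `a²` is central, while `u` and `uz`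
    -- both square to `z`. So `a` and `b` would commute modulo `⟨z⟩`.
    · exfalso
      obtain ⟨p, hp, habp⟩ := hcomm a b
      have hpp : p * p = 1 := by
        have h1 : a * a * b = b * (a * a) * (p * p) := by
          calc a * a * b = a * (b * a * p) := by rw [mul_assoc, habp]
            _ = a * b * a * p := by group
            _ = b * a * (p * a) * p := by rw [habp]; group
            _ = b * a * (a * p) * p := by rw [hPc p hp a]
            _ = _ := by group
        rw [← hPc _ (hsq a), left_eq_mul] at h1
        exact h1
      rcases hp with rfl | rfl | rfl | rfl
      · exact hab (Or.inl (by rw [habp, mul_one]))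
      · exact hab (Or.inr habp)
      · exact hz (by rw [← h, hpp])
      · rw [hzr, ← mul_assoc, hzz', h] at hpp
        exact hz hpp
    · exact absurd (mul_eq_left.1 h) huz.1
    · exact absurd (mul_left_cancel h) huz.2
  -- the class 2 case: `Z(G) = {1, z, u, u * z}`
  let ι : ZMod 2 × ZMod 2 → G := fun c => involutionMap u c.1 * involutionMap z c.2
  have h10 : (1 : ZMod 2) ≠ 0 := by decide
  have hι : ∀ p, (p = 1 ∨ p = z ∨ p = u ∨ p = u * z) → ∃ c, p = ι c := by
    rintro p (rfl | rfl | rfl | rfl)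
    · exact ⟨(0, 0), by simp [ι, involutionMap]⟩
    · exact ⟨(0, 1), by simp [ι, involutionMap]⟩
    · exact ⟨(1, 0), by simp [ι, involutionMap]⟩
    · exact ⟨(1, 1), by simp [ι, involutionMap]⟩
  have hq : ∀ g, ∃ c, g * g = ι c := fun g => hι _ (hsq g)
  have hB : ∀ g h, ∃ c, g * h = h * g * ι c := fun g h => by
    obtain ⟨p, hp, h1⟩ := hcomm g h
    obtain ⟨c, rfl⟩ := hι p hp
    exact ⟨c, h1⟩
  choose q hq using hq
  choose B hB using hB
  have huc' : ∀ g, g * u = u * g := fun g => (huc g).symm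
  have hιadd : ∀ c d, ι (c + d) = ι c * ι d := fun c d => by
    show involutionMap u (c.1 + d.1) * involutionMap z (c.2 + d.2) =
      involutionMap u c.1 * involutionMap z c.2 * (involutionMap u d.1 * involutionMap z d.2)
    rw [involutionMap_add huu, involutionMap_add hzz, mul_assoc, mul_assoc,
      ← mul_assoc (involutionMap u d.1), ← mul_assoc (involutionMap z c.2),
      involutionMap_comm huc' d.1 (involutionMap z c.2)]
  have hι1 : ∀ c, ι c = 1 → c = 0 := by
    rintro ⟨c, d⟩ h
    rcases ZMod.two_eq_zero_or_one c with rfl | rfl <;>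
      rcases ZMod.two_eq_zero_or_one d with rfl | rfl <;>
      simp only [ι, involutionMap, h10, if_true, if_false, mul_one, one_mul] at h
    · rfl
    · exact absurd h hz
    · exact absurd h huz.1
    · refine absurd ?_ huz.2
      rw [← hzz' u, h, one_mul]
  have hself : ∀ c : ZMod 2 × ZMod 2, c + c = 0 := by decide
  let Φ : CentralForm G (ZMod 2 × ZMod 2) :=
    { ι := ι
      ι_add := hιadd
      ι_injective := fun c d h => by
        have h1 : ι (c + d) = 1 := by
          rw [hιadd, h, ← hιadd, hself]
          simp [ι, involutionMap]
        have h2 := hι1 _ h1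
        rw [← hself d] at h2
        exact add_right_cancel h2
      ι_comm := fun c g => by
        show g * (involutionMap u c.1 * involutionMap z c.2) =
          involutionMap u c.1 * involutionMap z c.2 * g
        rw [← mul_assoc, involutionMap_comm huc', mul_assoc, involutionMap_comm hzc, mul_assoc]
      add_self := hself
      q := q
      B := B
      mul_self := hq
      mul_comm := hB }
  refine Φ.not_isFilled_of_extraspecial_quotients ⟨a, ?_⟩ fun c hc => ?_
  · rintro ⟨c, hc⟩
    refine hab (Or.inl ?_)
    rw [← hc]
    exact (Φ.ι_comm c b).symm
  · refine hquot _ (fun h => hc (hι1 c h)) ?_ (Φ.ι_comm c)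
    rw [Φ.ι_mul_ι, Φ.add_self, Φ.ι_zero]

/-- The structure of a filled group of order `2 ^ n` in terms of those of order `2 ^ (n - 1)`. -/
theorem IsFilled.structure {n : ℕ} (hn : n ≠ 0) (hcard : Nat.card G = 2 ^ n) (hG : IsFilled G)
    (hind : ∀ (H : Type u) [Group H], Nat.card H = 2 ^ (n - 1) → IsFilled H →
      IsElementaryAbelianTwo H ∨ IsExtraspecialTwo H) :
    IsElementaryAbelianTwo G ∨ IsExtraspecialTwo G ∨
      ∃ (E : Type u) (_ : Group E), Nat.card E = 2 ^ (n - 1) ∧ IsFilled E ∧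
        IsExtraspecialTwo E ∧ Nonempty (G ≃* E × Multiplicative (ZMod 2)) := by
  have hfin : Finite G := Nat.finite_of_card_ne_zero (by rw [hcard]; positivity)
  have : Nontrivial G := Finite.one_lt_card_iff_nontrivial.1
    (by rw [hcard]; exact Nat.one_lt_two_pow hn)
  have hpG : IsPGroup 2 G := IsPGroup.of_card hcard
  -- If the conclusion fails, no quotient by a central involution is elementary abelian, so all are
  -- extraspecial.
  by_contra hnot
  refine not_isFilled_of_forall_extraspecial_quotient hpG (fun z hz hzz hzc => ?_) hG
  obtain ⟨E, hE, π, hπ, hker, hcardE, hfillE⟩ := exists_central_quotient hcard hn hG hz hzz hzc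
  refine ⟨E, hE, π, hπ, hker, ?_, hfillE⟩
  refine (hind E hcardE hfillE).resolve_left fun h => hnot ?_
  refine hG.of_elementaryAbelian_quotient hcard hn hind hz hzz hzc (fun g => ?_) fun g k => ?_
  · rw [← hker, map_mul, ← pow_two, h.2]
  · exact (map_mul_comm_iff hker).1 (h.1 _ _)

end FilledGroup

theorem mainTheorem8 (n : ℕ) (hn : 1 < n) (G : Type u) [Group G]
    (hcard : Nat.card G = 2 ^ n) (hG : FilledGroup.IsFilled G) :
    ((∀ (H : Type u) [Group H], Nat.card H = 2 ^ (n - 1) → FilledGroup.IsFilled H →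
        FilledGroup.IsElementaryAbelianTwo H ∨ FilledGroup.IsExtraspecialTwo H) →
      FilledGroup.IsElementaryAbelianTwo G ∨ FilledGroup.IsExtraspecialTwo G ∨
        ∃ (E : Type u) (_ : Group E), Nat.card E = 2 ^ (n - 1) ∧ FilledGroup.IsFilled E ∧
          FilledGroup.IsExtraspecialTwo E ∧ Nonempty (G ≃* E × Multiplicative (ZMod 2))) ∧
    ((∀ (H : Type u) [Group H], Nat.card H = 2 ^ (n - 1) → FilledGroup.IsFilled H →
        FilledGroup.IsElementaryAbelianTwo H) →
      FilledGroup.IsElementaryAbelianTwo G ∨ FilledGroup.IsExtraspecialTwo G) := by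
  have hn0 : n ≠ 0 := by omega
  refine ⟨fun hind => hG.structure hn0 hcard hind, fun hind => ?_⟩
  rcases hG.structure hn0 hcard fun H _ h1 h2 => Or.inl (hind H h1 h2) with
    h | h | ⟨E, _, hcardE, hfillE, hE, -⟩
  · exact Or.inl h
  · exact Or.inr h
  · exact absurd (hind E hcardE hfillE).1 hE.not_comm
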